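/- Work in units with speed of light $1$. A \emph{static spacetime} is given in static coordinates $(x^0,x)$ on $\mathbb R\times\Omega$, with $\Omega\subseteq\mathbb R^3$ open, by a smooth Lorentzian metric $g$ of signature $(-,+,+,+)$ whose components do not depend on the time coordinate $x^0$ and satisfy $g_{0i}=0$ for $i=1,2,3$; $\partial/\partial x^0$ is future-pointing. For $\varepsilon>0$, $L>0$ and $x_1\in\mathbb R^3$, call it \emph{$\varepsilon$-gently curved at scale $L$ around $x_1$} if the ball $B(x_1,2L)$ is contained in $\Omega$ and, on $V=\mathbb R\times B(x_1,2L)$, the components of $g$ satisfy $$|g_{ij}-\eta_{ij}|\le\varepsilon,\qquad L\,|\partial_k g_{ij}|\le\varepsilon,\qquad L^2\,|\partial_k\partial_l g_{ij}|\le\varepsilon,$$ where $(\eta_{ij})=\mathrm{diag}(-1,1,1,1)$ (so the components of the Riemann tensor there are at most of order $\varepsilon/L^2$). An \emph{open machine} is a smoothly embedded future-pointing timelike worldline parametrized by the readings $\zeta\in\mathbb R$ of its clock; its ticks are the integer readings, and a reading $m.\phi$ stands for $m+\phi$, with count $m\in\mathbb Z$ and phase $\phi\in(-\tfrac12,\tfrac12]$.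 A \emph{signal} is a future-pointing null geodesic contained in $V$. A \emph{channel} from $A$ to $B$ is a set of pairs ($A$-reading, $B$-reading) such that, for each pair, a signal transmitted by $A$ at the first reading is received by $B$ at the second, and what is transmitted later arrives later. The \emph{echo count} from $A$ to $B$ and back is $n$ if, for each tick $k$ of $A$, the signal transmitted by $A$ at $k$ and echoed by $B$ without delay returns to $A$ at the reading $k+n$ and at no other. $A$ and $B$ are \emph{radar linkable} in $V$ if both worldlines lie in $V$ and every point of the worldline of $A$ is reached by exactly one future-pointing and exactly one past-pointing null geodesic in $V$ from the worldline of $B$ (up to affine reparametrization). \textbf{Proposition.} For every $\delta>0$ there is $\varepsilon>0$ with the following property. Let $p_\tau>0$, let $N$ be a positive integer, put $L=Np_\tau$, and let a static spacetime be $\varepsilon$-gently curved at scale $L$ around a position $x_1$. Then there are four open machines $V_1,V_2,V_3,V_4$, at rest at positions $q_1=x_1,q_2,q_3,q_4$, such that: (1) there are the vertices $r_1,\dots,r_4$ of a regular tetrahedron of edge length $L$ in the Euclidean coordinate space with $|q_i-r_i|\le\delta L$ for all $i$; (2) each unit of the reading of the clock of $V_1$ takes the proper time $p_\tau$; (3)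 for all $i\ne j$, $V_i$ and $V_j$ are radar linkable in $V$, the set $\{(k.0,(k+N).0): k\in\mathbb Z\}$ is a channel from $V_i$ to $V_j$ (so there are six two-way channels, all with null phases), and the echo count from $V_i$ to $V_j$ and back is $2N$. -/

import Mathlib

open Set
open scoped ContDiff

noncomputable section

/-- Static coordinates `(x⁰, x¹, x², x³)` of an event, `x⁰` being the time coordinate (units with
speed of light one). -/
abbrev Event : Type := Fin 4 → ℝ

/-- Space coordinates `(x¹, x², x³)`. -/
abbrev Pos : Type := EuclideanSpace ℝ (Fin 3)

/-- The space coordinates of an event. -/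
def spacePart (x : Event) : Pos := WithLp.toLp 2 (fun i => x i.succ)

/-- All events whose space coordinates lie in `B`. -/
def cylinder (B : Set Pos) : Set Event := {x | spacePart x ∈ B}

/-- The partial derivative `∂ f / ∂ xᵏ`. -/
def pd (k : Fin 4) (f : Event → ℝ) (x : Event) : ℝ :=
  fderiv ℝ f x (Pi.single k 1)

/-- The components of the Minkowski metric `diag (-1, 1, 1, 1)`. -/
def minkowski (i j : Fin 4) : ℝ :=
  if i = j then (if i = 0 then -1 else 1) else 0

/-- A region of a static spacetime, in static coordinates: a smooth metric of signature
`(-, +, +, +)` on `ℝ × space` whose components do not depend on the time coordinate and which has no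
terms mixing time and space. -/
structure StaticSpacetime where
  space : Set Pos
  isOpen_space : IsOpen space
  metric : Event → Matrix (Fin 4) (Fin 4) ℝ
  smooth : ∀ i j, ContDiffOn ℝ ∞ (fun x => metric x i j) (cylinder space)
  symm : ∀ x ∈ cylinder space, ∀ i j, metric x i j = metric x j i
  time_independent : ∀ x ∈ cylinder space, ∀ y, spacePart x = spacePart y → metric x = metric y
  mixed_zero : ∀ x ∈ cylinder space, ∀ i : Fin 3, metric x 0 i.succ = 0
  time_neg : ∀ x ∈ cylinder space, metric x 0 0 < 0
  space_pos : ∀ x ∈ cylinder space, ∀ v : Fin 3 → ℝ, v ≠ 0 →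
    0 < ∑ i, ∑ j, metric x i.succ j.succ * v i * v j

namespace StaticSpacetime

variable (S : StaticSpacetime)

/-- The inner product `g_x(u, v)` of two tangent vectors at `x`. -/
def inner (x u v : Event) : ℝ := ∑ i, ∑ j, S.metric x i j * u i * v j

/-- The tangent vector `v` at `x` is future-pointing (for causal `v`), the time orientation being
the one of the coordinate vector field `∂/∂x⁰`. -/
def FuturePointing (x v : Event) : Prop := S.inner x v (Pi.single 0 1) < 0

/-- The tangent vector `v` at `x` is past-pointing (for causal `v`). -/
def PastPointing (x v : Event) : Prop := 0 < S.inner x v (Pi.single 0 1)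

/-- The Christoffel symbol `Γᵏᵢⱼ` of the Levi-Civita connection. -/
def christoffel (k i j : Fin 4) (x : Event) : ℝ :=
  (1 / 2) * ∑ l, (S.metric x)⁻¹ k l *
    (pd i (fun y => S.metric y j l) x + pd j (fun y => S.metric y i l) x
      - pd l (fun y => S.metric y i j) x)

/-- `γ`, with velocity `v`, is an affinely parametrized null geodesic segment, parametrized by
`[0, 1]` and contained in the region `V`. -/
structure IsNullGeodesic (V : Set Event) (γ v : ℝ → Event) : Prop where
  mem : ∀ s ∈ Icc (0 : ℝ) 1, γ s ∈ V
  velocity : ∀ s ∈ Icc (0 : ℝ) 1, HasDerivWithinAt γ (v s) (Icc 0 1) s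
  geodesic : ∀ s ∈ Icc (0 : ℝ) 1,
    HasDerivWithinAt v (fun k => -∑ i, ∑ j, S.christoffel k i j (γ s) * v s i * v s j)
      (Icc 0 1) s
  null : ∀ s ∈ Icc (0 : ℝ) 1, S.inner (γ s) (v s) (v s) = 0

/-- `γ` is a future-pointing null geodesic segment in `V`. -/
def IsFutureNullGeodesic (V : Set Event) (γ : ℝ → Event) : Prop :=
  ∃ v, S.IsNullGeodesic V γ v ∧ ∀ s ∈ Icc (0 : ℝ) 1, S.FuturePointing (γ s) (v s)

/-- `γ` is a past-pointing null geodesic segment in `V`. -/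
def IsPastNullGeodesic (V : Set Event) (γ : ℝ → Event) : Prop :=
  ∃ v, S.IsNullGeodesic V γ v ∧ ∀ s ∈ Icc (0 : ℝ) 1, S.PastPointing (γ s) (v s)

/-- The spacetime is gently curved, with tolerance `ε`, at the length scale `L` around the position
`x₁`: its static coordinates cover the ball of radius `2 L` about `x₁`, and there the metric
components differ from those of the Minkowski metric by at most `ε`, their first derivatives are at
most `ε / L` and their second derivatives at most `ε / L²`. (The components of the Riemann tensor
are then at most a numerical constant times `ε / L²`.) -/
def IsGentle (ε : ℝ) (x₁ : Pos) (L : ℝ) : Prop :=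
  Metric.ball x₁ (2 * L) ⊆ S.space ∧
  ∀ x ∈ cylinder (Metric.ball x₁ (2 * L)), ∀ i j : Fin 4,
    |S.metric x i j - minkowski i j| ≤ ε ∧
    (∀ k, L * |pd k (fun y => S.metric y i j) x| ≤ ε) ∧
    (∀ k l, L ^ 2 * |pd k (pd l (fun y => S.metric y i j)) x| ≤ ε)

end StaticSpacetime

/-- An open machine: a smoothly embedded future-pointing timelike worldline, parametrized by the
readings of the clock of the machine. -/
structure OpenMachine (S : StaticSpacetime) where
  worldline : ℝ → Event
  mem : ∀ ζ, worldline ζ ∈ cylinder S.space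
  smooth : ContDiff ℝ ∞ worldline
  embedding : Topology.IsEmbedding worldline
  timelike : ∀ ζ, S.inner (worldline ζ) (deriv worldline ζ) (deriv worldline ζ) < 0
  future : ∀ ζ, S.FuturePointing (worldline ζ) (deriv worldline ζ)

/-- A clock reading `m.φ`: the count `m` of cycles and the phase `φ` within the cycle. -/
structure Reading where
  count : ℤ
  phase : ℝ
  phase_mem : phase ∈ Ioc (-1 / 2 : ℝ) (1 / 2)

/-- The clock reading `m.φ` as the real number `m + φ`. -/
def Reading.value (a : Reading) : ℝ := a.count + a.phase

/-- The reading `m.0`. -/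
def Reading.null (m : ℤ) : Reading where
  count := m
  phase := 0
  phase_mem := by norm_num

/-- The endlessly repeating set of pairs `{(k.0, (k + N).0) | k any integer}`. -/
def nullPhasePairs (N : ℕ) : Set (Reading × Reading) :=
  {c | ∃ k : ℤ, c = (Reading.null k, Reading.null (k + N))}

namespace OpenMachine

variable {S : StaticSpacetime}

/-- The machine stays at the space coordinates `q`. -/
def AtRest (A : OpenMachine S) (q : Pos) : Prop := ∀ ζ, spacePart (A.worldline ζ) = q

/-- Proper time elapsed on the worldline between the clock readings `a` and `b`. -/
def properTime (A : OpenMachine S) (a b : ℝ) : ℝ :=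
  ∫ ζ in a..b, Real.sqrt (-S.inner (A.worldline ζ) (deriv A.worldline ζ) (deriv A.worldline ζ))

/-- Each cycle of the clock, that is, each unit of its reading, takes the proper time `p`. -/
def HasProperPeriod (A : OpenMachine S) (p : ℝ) : Prop := ∀ ζ : ℝ, A.properTime ζ (ζ + 1) = p

/-- A signal transmitted by `A` at its clock reading `α` and propagating in `V` is received by `B`
at the clock reading `β` of `B`. -/
def Signal (V : Set Event) (A B : OpenMachine S) (α β : ℝ) : Prop :=
  ∃ γ : ℝ → Event, S.IsFutureNullGeodesic V γ ∧ γ 0 = A.worldline α ∧ γ 1 = B.worldline β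

/-- `C` is an order-preserving channel from `A` to `B` for signals in `V`: for every pair in `C` a
signal transmitted at the first reading is received at the second one, and what is transmitted
later arrives later. -/
def IsChannel (V : Set Event) (A B : OpenMachine S) (C : Set (Reading × Reading)) : Prop :=
  (∀ c ∈ C, Signal V A B c.1.value c.2.value) ∧
  (∀ c ∈ C, ∀ d ∈ C, c.1.value < d.1.value → c.2.value < d.2.value)

/-- The echo count from `A` to `B` and back is `n`: for each tick `k` of `A`, the signal transmitted
by `A` at `k` and echoed by `B` without delay returns to `A` at the reading `k + n`, and at no other
reading. -/
def HasEchoCount (V : Set Event) (A B : OpenMachine S) (n : ℕ) : Prop :=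
  ∀ k : ℤ,
    (∃ β, Signal V A B k β ∧ Signal V B A β (k + n)) ∧
    (∀ β α, Signal V A B k β → Signal V B A β α → α = k + n)

/-- `A` and `B` are radar linkable in the region `U` of the open region `V`: both worldlines lie in
`V`, and each point `a` of the worldline of `A` in `U` is reached by exactly one future-pointing and
by exactly one past-pointing null geodesic in `V` from the worldline of `B`. (Parametrization by
`[0, 1]` fixes the affine parameter.) -/
def RadarLinkable (V U : Set Event) (A B : OpenMachine S) : Prop :=
  IsOpen V ∧ IsOpen U ∧ U ⊆ V ∧ range A.worldline ⊆ V ∧ range B.worldline ⊆ V ∧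
  ∀ a ∈ range A.worldline ∩ U,
    (∃ γ, (S.IsFutureNullGeodesic V γ ∧ γ 0 ∈ range B.worldline ∧ γ 1 = a) ∧
      ∀ δ, S.IsFutureNullGeodesic V δ → δ 0 ∈ range B.worldline → δ 1 = a →
        EqOn δ γ (Icc 0 1)) ∧
    (∃ γ, (S.IsPastNullGeodesic V γ ∧ γ 0 ∈ range B.worldline ∧ γ 1 = a) ∧
      ∀ δ, S.IsPastNullGeodesic V δ → δ 0 ∈ range B.worldline → δ 1 = a →
        EqOn δ γ (Icc 0 1))

end OpenMachine

end

noncomputable section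

/-- `f` is bounded by `K` and Lipschitz with constant `K` on `s`. -/
def BddLip {X : Type*} [PseudoMetricSpace X] (K : ℝ) (s : Set X) (f : X → ℝ) : Prop :=
  (∀ x ∈ s, |f x| ≤ K) ∧ ∀ x ∈ s, ∀ y ∈ s, |f x - f y| ≤ K * dist x y

namespace BddLip

variable {X Y ι : Type*} [PseudoMetricSpace X] [PseudoMetricSpace Y] {K M : ℝ} {s : Set X}
  {f g : X → ℝ}

lemma mono (hf : BddLip K s f) (h : K ≤ M) : BddLip M s f :=
  ⟨fun x hx => (hf.1 x hx).trans h, fun x hx y hy => (hf.2 x hx y hy).trans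
    (mul_le_mul_of_nonneg_right h dist_nonneg)⟩

lemma const {c : ℝ} (h : |c| ≤ K) : BddLip K s fun _ => c :=
  ⟨fun _ _ => h, fun x _ y _ => by
    simpa using mul_nonneg ((abs_nonneg c).trans h) (dist_nonneg (x := x) (y := y))⟩

lemma congr (hf : BddLip K s f) (h : EqOn f g s) : BddLip K s g :=
  ⟨fun x hx => h hx ▸ hf.1 x hx, fun x hx y hy => h hx ▸ h hy ▸ hf.2 x hx y hy⟩

lemma neg (hf : BddLip K s f) : BddLip K s fun x => -f x :=
  ⟨fun x hx => by simpa using hf.1 x hx, fun x hx y hy => by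
    have := hf.2 x hx y hy
    rwa [show -f x - -f y = -(f x - f y) by ring, abs_neg]⟩

lemma add (hf : BddLip K s f) (hg : BddLip M s g) : BddLip (K + M) s fun x => f x + g x :=
  ⟨fun x hx => (abs_add_le _ _).trans (add_le_add (hf.1 x hx) (hg.1 x hx)), fun x hx y hy => by
    rw [show f x + g x - (f y + g y) = (f x - f y) + (g x - g y) by ring, add_mul]
    exact (abs_add_le _ _).trans (add_le_add (hf.2 x hx y hy) (hg.2 x hx y hy))⟩

lemma sub (hf : BddLip K s f) (hg : BddLip M s g) : BddLip (K + M) s fun x => f x - g x := by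
  simpa only [sub_eq_add_neg] using hf.add hg.neg

lemma mul (hf : BddLip K s f) (hg : BddLip M s g) : BddLip (2 * K * M) s fun x => f x * g x := by
  refine ⟨fun x hx => ?_, fun x hx y hy => ?_⟩
  · have hK := (abs_nonneg _).trans (hf.1 x hx)
    have hM := (abs_nonneg _).trans (hg.1 x hx)
    rw [abs_mul]
    nlinarith [mul_le_mul (hf.1 x hx) (hg.1 x hx) (abs_nonneg _) hK, mul_nonneg hK hM]
  · have hK := (abs_nonneg _).trans (hf.1 x hx)
    have hM := (abs_nonneg _).trans (hg.1 x hx)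
    rw [show f x * g x - f y * g y = (f x - f y) * g x + f y * (g x - g y) by ring]
    refine (abs_add_le _ _).trans ?_
    rw [abs_mul, abs_mul]
    have h1 := mul_le_mul (hf.2 x hx y hy) (hg.1 x hx) (abs_nonneg _)
      (mul_nonneg hK dist_nonneg)
    have h2 := mul_le_mul (hf.1 y hy) (hg.2 x hx y hy) (abs_nonneg _) hK
    linarith

lemma const_mul (c : ℝ) (hf : BddLip K s f) : BddLip (|c| * K) s fun x => c * f x :=
  ⟨fun x hx => by rw [abs_mul]; exact mul_le_mul_of_nonneg_left (hf.1 x hx) (abs_nonneg c),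
    fun x hx y hy => by
      rw [← mul_sub, abs_mul, mul_assoc]
      exact mul_le_mul_of_nonneg_left (hf.2 x hx y hy) (abs_nonneg c)⟩

lemma sum [Fintype ι] {f : ι → X → ℝ} (hf : ∀ i, BddLip K s (f i)) :
    BddLip (Fintype.card ι * K) s fun x => ∑ i, f i x := by
  refine ⟨fun x hx => ?_, fun x hx y hy => ?_⟩
  · refine (Finset.abs_sum_le_sum_abs _ _).trans ?_
    simpa [Finset.card_univ] using Finset.sum_le_card_nsmul Finset.univ (fun i => |f i x|) K
      (fun i _ => (hf i).1 x hx)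
  · rw [← Finset.sum_sub_distrib]
    refine (Finset.abs_sum_le_sum_abs _ _).trans ?_
    simpa [Finset.card_univ, mul_assoc] using
      Finset.sum_le_card_nsmul Finset.univ (fun i => |f i x - f i y|) (K * dist x y)
      (fun i _ => (hf i).2 x hx y hy)

/-- Precomposition with a map of Lipschitz constant `C ≥ 1`. -/
lemma comp {C : ℝ} {t : Set Y} {φ : Y → X} (hf : BddLip K s f) (hC : 1 ≤ C) (hφ : MapsTo φ t s)
    (hL : ∀ x ∈ t, ∀ y ∈ t, dist (φ x) (φ y) ≤ C * dist x y) :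
    BddLip (C * K) t fun x => f (φ x) := by
  refine ⟨fun x hx => ?_, fun x hx y hy => ?_⟩
  · have h := hf.1 _ (hφ hx)
    nlinarith [(abs_nonneg _).trans h]
  · have h := hf.2 _ (hφ hx) _ (hφ hy)
    have hK := (abs_nonneg _).trans (hf.1 _ (hφ hx))
    calc _ ≤ _ := h
      _ ≤ K * (C * dist x y) := mul_le_mul_of_nonneg_left (hL x hx y hy) hK
      _ = _ := by ring

/-- The truncation of a real number to `[-K, K]`. -/
lemma clamp (hK : 0 ≤ K) : (∀ x : ℝ, |max (-K) (min K x)| ≤ K) ∧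
    (∀ x y : ℝ, |max (-K) (min K x) - max (-K) (min K y)| ≤ |x - y|) ∧
    ∀ x : ℝ, |x| ≤ K → max (-K) (min K x) = x := by
  refine ⟨fun x => ?_, fun x y => ?_, fun x hx => ?_⟩
  · rw [abs_le]
    exact ⟨le_max_left _ _, max_le (by linarith) (min_le_left _ _)⟩
  · refine (abs_max_sub_max_le_max _ _ _ _).trans (max_le (by simp) ?_)
    exact (abs_min_sub_min_le_max _ _ _ _).trans (max_le (by simp) le_rfl)
  · have := abs_le.1 hx
    rw [min_eq_right this.2, max_eq_right this.1]

lemma exists_extension (hf : BddLip K s f) (hK : 0 ≤ K) :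
    ∃ g : X → ℝ, BddLip K univ g ∧ EqOn g f s := by
  have hL : LipschitzOnWith ⟨K, hK⟩ f s := LipschitzOnWith.of_dist_le_mul fun x hx y hy => by
    rw [Real.dist_eq]; exact hf.2 x hx y hy
  obtain ⟨g, hg, hfg⟩ := hL.extend_real
  obtain ⟨h1, h2, h3⟩ := clamp hK
  refine ⟨fun x => max (-K) (min K (g x)), ⟨fun x _ => h1 _, fun x _ y _ => (h2 _ _).trans ?_⟩,
    fun x hx => ?_⟩
  · rw [← Real.dist_eq]; exact hg.dist_le_mul x y
  · simp only [← hfg hx]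
    exact h3 _ (hf.1 x hx)

end BddLip

section BoundaryValue

variable {E : Type*} [NormedAddCommGroup E] [NormedSpace ℝ E]

/-- `y`, with velocity `w`, solves the second-order equation `y'' = F(y, y')` on `[0, 1]`. -/
structure IsSol (F : E → E → E) (y w : ℝ → E) : Prop where
  vel : ∀ s ∈ Icc (0 : ℝ) 1, HasDerivWithinAt y (w s) (Icc 0 1) s
  acc : ∀ s ∈ Icc (0 : ℝ) 1, HasDerivWithinAt w (F (y s) (w s)) (Icc 0 1) s

/-- A bound `κ` for `F`, also serving as a Lipschitz constant. -/
structure SmallField (κ : ℝ) (F : E → E → E) : Prop where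
  bound : ∀ y w, ‖F y w‖ ≤ κ
  lip : ∀ y w y' w', ‖F y w - F y' w'‖ ≤ κ * (‖y - y'‖ + ‖w - w'‖)

lemma norm_velocity_sub_le {y w a : ℝ → E} {K : ℝ}
    (hy : ∀ s ∈ Icc (0 : ℝ) 1, HasDerivWithinAt y (w s) (Icc 0 1) s)
    (hw : ∀ s ∈ Icc (0 : ℝ) 1, HasDerivWithinAt w (a s) (Icc 0 1) s)
    (ha : ∀ s ∈ Icc (0 : ℝ) 1, ‖a s‖ ≤ K) {s : ℝ} (hs : s ∈ Icc (0 : ℝ) 1) :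
    ‖w s - (y 1 - y 0)‖ ≤ K := by
  have hK : 0 ≤ K := (norm_nonneg _).trans (ha s hs)
  have hd : ∀ r ∈ Icc (0 : ℝ) 1,
      HasDerivWithinAt (fun r => y r - r • w s) (w r - w s) (Icc 0 1) r := fun r hr => 
    ((hy r hr).sub ((hasDerivWithinAt_id r _).smul_const (w s))).congr_deriv (by simp)
  have hb : ∀ r ∈ Icc (0 : ℝ) 1, ‖w r - w s‖ ≤ K := fun r hr => by
    refine ((convex_Icc 0 1).norm_image_sub_le_of_norm_hasDerivWithin_le hw ha hs hr).trans ?_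
    have : ‖r - s‖ ≤ 1 := by
      rw [Real.norm_eq_abs, abs_le]; constructor <;> linarith [hr.1, hr.2, hs.1, hs.2]
    nlinarith
  have := (convex_Icc 0 1).norm_image_sub_le_of_norm_hasDerivWithin_le hd hb
    (left_mem_Icc.2 zero_le_one) (right_mem_Icc.2 zero_le_one)
  simp only [one_smul, zero_smul, sub_zero, norm_one, mul_one] at this
  rwa [← norm_neg, show -(w s - (y 1 - y 0)) = y 1 - w s - y 0 by abel]

lemma norm_position_sub_le {y w : ℝ → E} {u : E} {K : ℝ}
    (hy : ∀ s ∈ Icc (0 : ℝ) 1, HasDerivWithinAt y (w s) (Icc 0 1) s)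
    (hw : ∀ s ∈ Icc (0 : ℝ) 1, ‖w s - u‖ ≤ K) {s : ℝ} (hs : s ∈ Icc (0 : ℝ) 1) :
    ‖y s - (y 0 + s • u)‖ ≤ K := by
  have hK : 0 ≤ K := (norm_nonneg _).trans (hw s hs)
  have hd : ∀ r ∈ Icc (0 : ℝ) 1,
      HasDerivWithinAt (fun r => y r - r • u) (w r - u) (Icc 0 1) r := fun r hr => 
    ((hy r hr).sub ((hasDerivWithinAt_id r _).smul_const u)).congr_deriv (by simp)
  have := (convex_Icc 0 1).norm_image_sub_le_of_norm_hasDerivWithin_le hd hw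
    (left_mem_Icc.2 zero_le_one) hs
  simp only [zero_smul, sub_zero, Real.norm_eq_abs, abs_of_nonneg hs.1] at this
  rw [show y s - (y 0 + s • u) = y s - s • u - y 0 by abel]
  nlinarith [hs.2]

namespace IsSol

variable {F : E → E → E} {κ : ℝ} {y w y' w' : ℝ → E}

lemma norm_vel_sub_le (h : IsSol F y w) (hF : SmallField κ F) {s : ℝ} (hs : s ∈ Icc (0 : ℝ) 1) :
    ‖w s - (y 1 - y 0)‖ ≤ κ :=
  norm_velocity_sub_le h.vel h.acc (fun _ _ => hF.bound _ _) hs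

lemma norm_pos_sub_le (h : IsSol F y w) (hF : SmallField κ F) {s : ℝ} (hs : s ∈ Icc (0 : ℝ) 1) :
    ‖y s - (y 0 + s • (y 1 - y 0))‖ ≤ κ :=
  norm_position_sub_le h.vel (fun _ h' => h.norm_vel_sub_le hF h') hs

/-- Solutions depend in a Lipschitz way on their end points. -/
lemma stability (h : IsSol F y w) (h' : IsSol F y' w') (hF : SmallField κ F) (hκ : κ ≤ 1 / 4)
    {s : ℝ} (hs : s ∈ Icc (0 : ℝ) 1) :
    ‖y s - y' s‖ + ‖w s - w' s‖ ≤ 6 * (‖y 0 - y' 0‖ + ‖y 1 - y' 1‖) ∧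
    ‖(w s - (y 1 - y 0)) - (w' s - (y' 1 - y' 0))‖ ≤
      κ * (6 * (‖y 0 - y' 0‖ + ‖y 1 - y' 1‖)) := by
  have hκ0 : 0 ≤ κ := (norm_nonneg _).trans (hF.bound 0 0)
  have hc : ContinuousOn (fun s => ‖y s - y' s‖ + ‖w s - w' s‖) (Icc 0 1) := fun r hr =>
    ((h.vel r hr).continuousWithinAt.sub (h'.vel r hr).continuousWithinAt).norm.add
      ((h.acc r hr).continuousWithinAt.sub (h'.acc r hr).continuousWithinAt).norm
  obtain ⟨r, hr, hmax⟩ := isCompact_Icc.exists_isMaxOn ⟨s, hs⟩ hc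
  set Δ := ‖y r - y' r‖ + ‖w r - w' r‖ with hΔ
  have hmax : ∀ s ∈ Icc (0 : ℝ) 1, ‖y s - y' s‖ + ‖w s - w' s‖ ≤ Δ := fun s hs => hmax hs
  have hΔ0 : 0 ≤ Δ := by positivity
  set D := (y 1 - y' 1) - (y 0 - y' 0) with hD
  have hdy : ∀ s ∈ Icc (0 : ℝ) 1,
      HasDerivWithinAt (fun s => y s - y' s) (w s - w' s) (Icc 0 1) s :=
    fun s hs => (h.vel s hs).sub (h'.vel s hs)
  have hdw : ∀ s ∈ Icc (0 : ℝ) 1, ‖(w s - w' s) - D‖ ≤ κ * Δ := fun s hs =>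
    norm_velocity_sub_le (y := fun s => y s - y' s) hdy
      (fun s hs => (h.acc s hs).sub (h'.acc s hs))
      (fun s hs => (hF.lip _ _ _ _).trans (mul_le_mul_of_nonneg_left (hmax s hs) hκ0)) hs
  have hDn : ‖D‖ ≤ ‖y 0 - y' 0‖ + ‖y 1 - y' 1‖ := by
    rw [add_comm]; exact norm_sub_le _ _
  have hw1 : ∀ s ∈ Icc (0 : ℝ) 1, ‖w s - w' s‖ ≤ ‖D‖ + κ * Δ := fun s hs => by
    have := norm_add_le ((w s - w' s) - D) D
    rw [sub_add_cancel] at this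
    linarith [hdw s hs]
  have hy1 : ‖y r - y' r‖ ≤ ‖y 0 - y' 0‖ + (‖D‖ + κ * Δ) := by
    have h1 := norm_position_sub_le (u := 0) hdy (fun s hs => by simpa using hw1 s hs) hr
    simp only [smul_zero, add_zero] at h1
    have := norm_add_le ((y r - y' r) - (y 0 - y' 0)) (y 0 - y' 0)
    rw [sub_add_cancel] at this
    linarith
  have hfin : Δ ≤ 6 * (‖y 0 - y' 0‖ + ‖y 1 - y' 1‖) := by
    have := hw1 r hr
    have h2 : κ * Δ ≤ 1 / 4 * Δ := mul_le_mul_of_nonneg_right hκ hΔ0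
    linarith [norm_nonneg (y 1 - y' 1)]
  refine ⟨(hmax s hs).trans hfin, ?_⟩
  rw [show (w s - (y 1 - y 0)) - (w' s - (y' 1 - y' 0)) = (w s - w' s) - D by rw [hD]; abel]
  exact (hdw s hs).trans (mul_le_mul_of_nonneg_left hfin hκ0)

lemma eqOn (h : IsSol F y w) (h' : IsSol F y' w') (hF : SmallField κ F) (hκ : κ ≤ 1 / 4)
    (h0 : y 0 = y' 0) (h1 : y 1 = y' 1) {s : ℝ} (hs : s ∈ Icc (0 : ℝ) 1) :
    y s = y' s ∧ w s = w' s := by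
  have := (h.stability h' hF hκ hs).1
  simp only [h0, h1, sub_self, norm_zero, add_zero, mul_zero] at this
  constructor
  · rw [← sub_eq_zero, ← norm_eq_zero]
    linarith [norm_nonneg (y s - y' s), norm_nonneg (w s - w' s)]
  · rw [← sub_eq_zero, ← norm_eq_zero]
    linarith [norm_nonneg (y s - y' s), norm_nonneg (w s - w' s)]

lemma reverse (h : IsSol F y w) (hF : ∀ s ∈ Icc (0 : ℝ) 1, F (y s) (-w s) = F (y s) (w s)) :
    IsSol F (fun s => y (1 - s)) (fun s => -w (1 - s)) := by
  have hm : MapsTo (fun s : ℝ => 1 - s) (Icc 0 1) (Icc 0 1) := fun s hs =>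
    ⟨by linarith [hs.2], by linarith [hs.1]⟩
  have hd : ∀ s ∈ Icc (0 : ℝ) 1, HasDerivWithinAt (fun s : ℝ => 1 - s) (-1) (Icc 0 1) s :=
    fun s _ => by simpa using (hasDerivWithinAt_id s _).const_sub 1
  refine ⟨fun s hs => ?_, fun s hs => ?_⟩
  · exact ((h.vel _ (hm hs)).scomp s (hd s hs) hm).congr_deriv (by simp)
  · rw [hF _ (hm hs)]
    exact ((h.acc _ (hm hs)).scomp s (hd s hs) hm).neg.congr_deriv (by simp)

end IsSol

end BoundaryValue

section BoundaryValueExistence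

variable {E : Type*} [NormedAddCommGroup E] [NormedSpace ℝ E]

lemma hasDerivAt_integral_of_continuous' [CompleteSpace E] {f : ℝ → E} (hf : Continuous f) (s : ℝ) :
    HasDerivAt (fun s => ∫ r in (0 : ℝ)..s, f r) (f s) s :=
  intervalIntegral.integral_hasDerivAt_right (hf.intervalIntegrable _ _)
    (hf.stronglyMeasurableAtFilter _ _) hf.continuousAt

lemma norm_integral_sub_le {f g : ℝ → E} (hf : Continuous f) (hg : Continuous g) {C : ℝ}
    (h : ∀ s ∈ Icc (0 : ℝ) 1, ‖f s - g s‖ ≤ C) {s : ℝ} (hs : s ∈ Icc (0 : ℝ) 1) :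
    ‖(∫ r in (0 : ℝ)..s, f r) - ∫ r in (0 : ℝ)..s, g r‖ ≤ C := by
  have hC : 0 ≤ C := (norm_nonneg _).trans (h s hs)
  rw [← intervalIntegral.integral_sub (hf.intervalIntegrable _ _) (hg.intervalIntegrable _ _)]
  refine (intervalIntegral.norm_integral_le_of_norm_le_const (C := C) fun r hr => ?_).trans ?_
  · rw [uIoc_of_le hs.1] at hr
    exact h r ⟨hr.1.le, hr.2.trans hs.2⟩
  · rw [sub_zero, abs_of_nonneg hs.1]
    nlinarith [hs.2]

/-- The two-point boundary value problem for `y'' = F(y, y')` with small `F`. -/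
theorem exists_isSol [CompleteSpace E] {F : E → E → E} {κ : ℝ} (hF : SmallField κ F) (hκ : κ ≤ 1 / 8) (a b : E) :
    ∃ y w : ℝ → E, IsSol F y w ∧ y 0 = a ∧ y 1 = b := by
  have hκ0 : 0 ≤ κ := (norm_nonneg _).trans (hF.bound 0 0)
  have hFc : Continuous fun p : E × E => F p.1 p.2 := by
    refine (LipschitzWith.of_dist_le_mul (K := ⟨2 * κ, by positivity⟩) fun p q => ?_).continuous
    rw [dist_eq_norm]
    refine (hF.lip _ _ _ _).trans ?_
    have h1 := norm_fst_le (p - q)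
    have h2 := norm_snd_le (p - q)
    simp only [Prod.fst_sub, Prod.snd_sub] at h1 h2
    rw [dist_eq_norm]
    change _ ≤ 2 * κ * ‖p - q‖
    nlinarith
  let V : C(Icc (0 : ℝ) 1, E) → ℝ → E := fun v s => v (projIcc 0 1 zero_le_one s)
  have hV : ∀ v, Continuous (V v) := fun v => v.continuous.comp continuous_projIcc
  let Y : C(Icc (0 : ℝ) 1, E) → ℝ → E := fun v s => a + ∫ r in (0 : ℝ)..s, V v r
  have hYd : ∀ v s, HasDerivAt (Y v) (V v s) s := fun v s =>
    (hasDerivAt_integral_of_continuous' (hV v) s).const_add a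
  have hY : ∀ v, Continuous (Y v) := fun v =>
    continuous_iff_continuousAt.2 fun s => (hYd v s).continuousAt
  let f : C(Icc (0 : ℝ) 1, E) → ℝ → E := fun v s => F (Y v s) (V v s)
  have hf : ∀ v, Continuous (f v) := fun v => hFc.comp ((hY v).prodMk (hV v))
  let g : C(Icc (0 : ℝ) 1, E) → ℝ → E := fun v s => ∫ r in (0 : ℝ)..s, f v r
  have hgd : ∀ v s, HasDerivAt (g v) (f v s) s := fun v s =>
    hasDerivAt_integral_of_continuous' (hf v) s
  have hg : ∀ v, Continuous (g v) := fun v =>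
    continuous_iff_continuousAt.2 fun s => (hgd v s).continuousAt
  let W : C(Icc (0 : ℝ) 1, E) → ℝ → E := fun v s => (b - a) + (g v s - ∫ r in (0 : ℝ)..1, g v r)
  have hW : ∀ v, Continuous (W v) := fun v => continuous_const.add ((hg v).sub continuous_const)
  let Φ : C(Icc (0 : ℝ) 1, E) → C(Icc (0 : ℝ) 1, E) := fun v =>
    ⟨fun s => W v s, (hW v).comp continuous_subtype_val⟩
  have hΦ : ContractingWith (1 / 2) Φ := by
    refine ⟨by rw [← NNReal.coe_lt_coe]; norm_num, LipschitzWith.of_dist_le_mul fun v v' => ?_⟩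
    rw [ContinuousMap.dist_le (by positivity)]
    intro s
    have hV' : ∀ s, ‖V v s - V v' s‖ ≤ dist v v' := fun s => by
      rw [← dist_eq_norm]; exact ContinuousMap.dist_apply_le_dist _
    have hY' : ∀ s ∈ Icc (0 : ℝ) 1, ‖Y v s - Y v' s‖ ≤ dist v v' := fun s hs => by
      simp only [Y, add_sub_add_left_eq_sub]
      exact norm_integral_sub_le (hV v) (hV v') (fun s _ => hV' s) hs
    have hf' : ∀ s ∈ Icc (0 : ℝ) 1, ‖f v s - f v' s‖ ≤ 2 * κ * dist v v' := fun s hs => by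
      refine (hF.lip _ _ _ _).trans ?_
      nlinarith [hY' s hs, hV' s]
    have hg' : ∀ s ∈ Icc (0 : ℝ) 1, ‖g v s - g v' s‖ ≤ 2 * κ * dist v v' := fun s hs =>
      norm_integral_sub_le (hf v) (hf v') hf' hs
    have hi := norm_integral_sub_le (hg v) (hg v') hg' (right_mem_Icc.2 zero_le_one)
    rw [dist_eq_norm]
    change ‖W v s - W v' s‖ ≤ _
    simp only [W, add_sub_add_left_eq_sub]
    rw [sub_sub_sub_comm]
    refine (norm_sub_le _ _).trans ((add_le_add (hg' s s.2) hi).trans ?_)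
    have := mul_le_mul_of_nonneg_right hκ (dist_nonneg (x := v) (y := v'))
    simp only [one_div, NNReal.coe_inv, NNReal.coe_ofNat]
    linarith
  obtain ⟨v, hv, -⟩ := hΦ.exists_fixedPoint 0 (edist_ne_top _ _)
  have hvW : ∀ s ∈ Icc (0 : ℝ) 1, V v s = W v s := fun s hs => by
    have := congrArg (fun u : C(Icc (0 : ℝ) 1, E) => u ⟨s, hs⟩) hv
    simp only [V, projIcc_of_mem zero_le_one hs]
    exact this.symm
  refine ⟨Y v, V v, ⟨fun s _ => (hYd v s).hasDerivWithinAt, fun s hs => ?_⟩, by simp [Y], ?_⟩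
  · have : HasDerivAt (W v) (f v s) s := ((hgd v s).sub_const _).const_add _
    exact this.hasDerivWithinAt.congr hvW (hvW s hs)
  · have : ∫ r in (0 : ℝ)..1, V v r = ∫ r in (0 : ℝ)..1, W v r :=
      intervalIntegral.integral_congr fun s hs => hvW s (by rwa [uIcc_of_le zero_le_one] at hs)
    have hc : ∀ c : E, IntervalIntegrable (fun _ => c) MeasureTheory.volume (0 : ℝ) 1 := fun c =>
      continuous_const.intervalIntegrable _ _
    have hgi := (hg v).intervalIntegrable (μ := MeasureTheory.volume) (0 : ℝ) 1
    have h2 : ∫ r in (0 : ℝ)..1, W v r = b - a := by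
      simp only [W]
      rw [intervalIntegral.integral_add (hc _) (hgi.sub (hc _)),
        intervalIntegral.integral_sub hgi (hc _)]
      simp
    simp only [Y, this, h2, add_sub_cancel]

end BoundaryValueExistence

section Quadratic

/-- The vector field of accelerations `-Q(y)(w, w)`. -/
def quadAcc (Q : Fin 3 → Fin 3 → Fin 3 → Pos → ℝ) (y w : Pos) : Pos :=
  WithLp.toLp 2 fun k => -∑ i, ∑ j, Q k i j y * (w i * w j)

lemma quadAcc_neg (Q : Fin 3 → Fin 3 → Fin 3 → Pos → ℝ) (y w : Pos) :
    quadAcc Q y (-w) = quadAcc Q y w := by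
  simp [quadAcc]

lemma norm_pos_le {v : Pos} {C : ℝ} (h : ∀ i, |v i| ≤ C) : ‖v‖ ≤ 3 * C := by
  have hC : 0 ≤ C := (abs_nonneg _).trans (h 0)
  rw [EuclideanSpace.norm_eq, Real.sqrt_le_left (by positivity), Fin.sum_univ_three]
  simp only [Real.norm_eq_abs]
  have := fun i => pow_le_pow_left₀ (abs_nonneg _) (h i) 2
  nlinarith [this 0, this 1, this 2]

lemma abs_apply_le_norm (v : Pos) (i : Fin 3) : |v i| ≤ ‖v‖ := PiLp.norm_apply_le v i

variable {Q : Fin 3 → Fin 3 → Fin 3 → Pos → ℝ} {κ : ℝ}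

/-- Inside the ball and for moderate velocities the quadratic field agrees with a globally defined
small field. -/
theorem exists_smallField (hκ : 0 ≤ κ)
    (hQ : ∀ k i j, BddLip κ (Metric.ball 0 2) (Q k i j)) :
    ∃ F : Pos → Pos → Pos, SmallField (43200 * κ) F ∧
      ∀ y ∈ Metric.ball (0 : Pos) 2, ∀ w : Pos, ‖w‖ ≤ 20 → F y w = quadAcc Q y w := by
  choose R hR hRQ using fun k i j => (hQ k i j).exists_extension hκ
  obtain ⟨c1, c2, c3⟩ := BddLip.clamp (K := 20) (by norm_num)
  set c : ℝ → ℝ := fun x => max (-20) (min 20 x) with hc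
  have hcl : ∀ i : Fin 3, BddLip 20 univ fun p : Pos × Pos => c (p.2 i) := fun i =>
    ⟨fun p _ => c1 _, fun p _ q _ => by
      refine (c2 _ _).trans ?_
      have h1 := abs_apply_le_norm (p.2 - q.2) i
      have h2 : ‖p.2 - q.2‖ ≤ dist p q := by rw [← dist_eq_norm]; exact le_max_right _ _
      simp only [PiLp.sub_apply] at h1
      linarith [dist_nonneg (x := p) (y := q)]⟩
  have hB : ∀ k i j, BddLip (2 * κ * (2 * 20 * 20)) univ
      fun p : Pos × Pos => R k i j p.1 * (c (p.2 i) * c (p.2 j)) := fun k i j =>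
    (((hR k i j).comp (C := 1) (φ := Prod.fst) (t := univ) le_rfl (mapsTo_univ _ _)
      (fun p _ q _ => by rw [one_mul]; exact le_max_left _ _)).mono (by linarith)).mul
      ((hcl i).mul (hcl j))
  have hS : ∀ k, BddLip (14400 * κ) univ
      fun p : Pos × Pos => -∑ i, ∑ j, R k i j p.1 * (c (p.2 i) * c (p.2 j)) := fun k =>
    (BddLip.sum fun i => BddLip.sum fun j => hB k i j).neg.mono (by simp; linarith)
  refine ⟨fun y w => WithLp.toLp 2 fun k => -∑ i, ∑ j, R k i j y * (c (w i) * c (w j)),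
    ⟨fun y w => ?_, fun y w y' w' => ?_⟩, fun y hy w hw => ?_⟩
  · refine (norm_pos_le fun k => (hS k).1 (y, w) (mem_univ _)).trans (by linarith)
  · have h := norm_pos_le (v := (WithLp.toLp 2 fun k => -∑ i, ∑ j, R k i j y * (c (w i) * c (w j)))
      - WithLp.toLp 2 fun k => -∑ i, ∑ j, R k i j y' * (c (w' i) * c (w' j)))
      (fun k => (hS k).2 (y, w) (mem_univ _) (y', w') (mem_univ _))
    have hd : dist (y, w) (y', w') ≤ ‖y - y'‖ + ‖w - w'‖ := by
      rw [Prod.dist_eq, dist_eq_norm, dist_eq_norm]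
      exact max_le (by simp) (by simp)
    refine h.trans ?_
    nlinarith [mul_le_mul_of_nonneg_left hd hκ]
  · have hw' : ∀ i, c (w i) = w i := fun i => c3 _ ((abs_apply_le_norm w i).trans hw)
    simp only [quadAcc, hw', hRQ _ _ _ hy]

lemma norm_quadAcc_le {y w : Pos} (hQ : ∀ k i j, |Q k i j y| ≤ κ) :
    ‖quadAcc Q y w‖ ≤ 27 * κ * ‖w‖ ^ 2 := by
  have hκ : 0 ≤ κ := (abs_nonneg _).trans (hQ 0 0 0)
  refine (norm_pos_le (C := 9 * κ * ‖w‖ ^ 2) fun k => ?_).trans (by linarith)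
  have h : ∀ i j, |Q k i j y * (w i * w j)| ≤ κ * ‖w‖ ^ 2 := fun i j => by
    rw [abs_mul, abs_mul, sq]
    exact mul_le_mul (hQ k i j) (mul_le_mul (abs_apply_le_norm w i) (abs_apply_le_norm w j)
      (abs_nonneg _) (norm_nonneg _)) (by positivity) hκ
  simp only [quadAcc, abs_neg]
  refine (Finset.abs_sum_le_sum_abs _ _).trans ?_
  refine (Finset.sum_le_sum fun i _ => (Finset.abs_sum_le_sum_abs _ _).trans
    (Finset.sum_le_sum fun j _ => h i j)).trans ?_
  simp only [Finset.sum_const, Finset.card_univ, Fintype.card_fin, nsmul_eq_mul, Nat.cast_ofNat]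
  linarith

/-- A solution of the quadratic equation that stays in the ball has moderate velocity. -/
theorem norm_velocity_le (hκ : κ ≤ 1 / 1000) (hQ : ∀ y ∈ Metric.ball (0 : Pos) 2,
    ∀ k i j, |Q k i j y| ≤ κ) {y w : ℝ → Pos} (h : IsSol (quadAcc Q) y w)
    (hy : ∀ s ∈ Icc (0 : ℝ) 1, y s ∈ Metric.ball (0 : Pos) 2) {s : ℝ} (hs : s ∈ Icc (0 : ℝ) 1) :
    ‖w s‖ ≤ 20 := by
  have hκ0 : 0 ≤ κ := (abs_nonneg _).trans (hQ _ (hy s hs) 0 0 0)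
  obtain ⟨r, hr, hmax⟩ := isCompact_Icc.exists_isMaxOn ⟨s, hs⟩
    (fun r hr => (h.acc r hr).continuousWithinAt.norm : ContinuousOn (fun s => ‖w s‖) (Icc 0 1))
  have hmax : ∀ s ∈ Icc (0 : ℝ) 1, ‖w s‖ ≤ ‖w r‖ := fun s hs => hmax hs
  refine (hmax s hs).trans ?_
  by_contra! hM
  set M := ‖w r‖ with hMd
  have hM0 : 0 < M := by linarith
  have hℓ : 10 / M ≤ 1 / 2 := by rw [div_le_iff₀ hM0]; linarith
  have hℓ0 : 0 < 10 / M := by positivity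
  have hMℓ : 10 / M * M = 10 := by field_simp
  obtain ⟨r', hr', hrr⟩ : ∃ r' ∈ Icc (0 : ℝ) 1, |r' - r| = 10 / M := by
    rcases le_total r (1 / 2) with h' | h'
    · exact ⟨r + 10 / M, ⟨by linarith [hr.1], by linarith⟩, by
        rw [add_sub_cancel_left, abs_of_pos hℓ0]⟩
    · exact ⟨r - 10 / M, ⟨by linarith, by linarith [hr.2]⟩, by
        rw [sub_sub_cancel_left, abs_neg, abs_of_pos hℓ0]⟩
  have hsub : uIcc r r' ⊆ Icc 0 1 := ordConnected_Icc.uIcc_subset hr hr'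
  have hacc : ∀ s ∈ Icc (0 : ℝ) 1, ‖quadAcc Q (y s) (w s)‖ ≤ 27 * κ * M ^ 2 := fun s hs =>
    (norm_quadAcc_le (hQ _ (hy s hs))).trans
      (mul_le_mul_of_nonneg_left (pow_le_pow_left₀ (norm_nonneg _) (hmax s hs) 2) (by positivity))
  have hd : ∀ u ∈ uIcc r r',
      HasDerivWithinAt (fun u => y u - u • w r) (w u - w r) (uIcc r r') u := fun u hu =>
    (((h.vel u (hsub hu)).mono hsub).sub
      ((hasDerivWithinAt_id u _).smul_const (w r))).congr_deriv (by simp)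
  have hb : ∀ u ∈ uIcc r r', ‖w u - w r‖ ≤ 27 * κ * M ^ 2 * (10 / M) := fun u hu => by
    refine ((convex_Icc 0 1).norm_image_sub_le_of_norm_hasDerivWithin_le h.acc hacc hr
      (hsub hu)).trans (mul_le_mul_of_nonneg_left ?_ (by positivity))
    rw [Real.norm_eq_abs, ← hrr]
    exact abs_sub_left_of_mem_uIcc hu
  have h1 := (convex_uIcc r r').norm_image_sub_le_of_norm_hasDerivWithin_le hd hb
    left_mem_uIcc right_mem_uIcc
  rw [Real.norm_eq_abs, hrr, show 27 * κ * M ^ 2 * (10 / M) * (10 / M) =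
    27 * κ * (10 / M * M) ^ 2 by ring, hMℓ] at h1
  have h2 : ‖(r' - r) • w r‖ = 10 := by rw [norm_smul, Real.norm_eq_abs, hrr, ← hMd, hMℓ]
  have h3 : ‖y r' - y r‖ < 4 := by
    have e1 := hy _ hr
    have e2 := hy _ hr'
    rw [mem_ball_zero_iff] at e1 e2
    linarith [norm_sub_le (y r') (y r)]
  have h4 : (r' - r) • w r = (y r' - y r) - ((y r' - r' • w r) - (y r - r • w r)) := by
    rw [sub_smul]; abel
  have h5 := norm_sub_le (y r' - y r) ((y r' - r' • w r) - (y r - r • w r))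
  rw [← h4, h2] at h5
  linarith

end Quadratic

section Tetrahedron

/-- The vertices, other than the origin, of a regular tetrahedron with edges of length one. -/
def tetraVertex : Fin 3 → Pos :=
  ![(√2)⁻¹ • !₂[1, 1, 0], (√2)⁻¹ • !₂[1, 0, 1], (√2)⁻¹ • !₂[0, 1, 1]]

/-- All four vertices. -/
def tetra : Fin 4 → Pos := Fin.cons 0 tetraVertex

lemma cons_apply {α : Type*} (a : α) (f : Fin 3 → α) :
    (Fin.cons a f : Fin 4 → α) 0 = a ∧ (Fin.cons a f : Fin 4 → α) 1 = f 0 ∧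
      (Fin.cons a f : Fin 4 → α) 2 = f 1 ∧ (Fin.cons a f : Fin 4 → α) 3 = f 2 :=
  ⟨rfl, rfl, rfl, rfl⟩

lemma inv_sqrt_two_sq : (√2 : ℝ)⁻¹ ^ 2 = 1 / 2 := by
  rw [inv_pow, Real.sq_sqrt (by norm_num)]; norm_num

lemma norm_sq_pos (v : Pos) : ‖v‖ ^ 2 = v 0 ^ 2 + v 1 ^ 2 + v 2 ^ 2 := by
  rw [EuclideanSpace.norm_sq_eq, Fin.sum_univ_three]; simp

lemma norm_tetra_sub {i j : Fin 4} (h : i ≠ j) : ‖tetra i - tetra j‖ = 1 := by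
  have h1 : ‖tetra i - tetra j‖ ^ 2 = 1 := by
    have h2 := inv_sqrt_two_sq
    rw [norm_sq_pos]
    fin_cases i <;> fin_cases j <;> first | exact absurd rfl h | skip
    all_goals
      simp [tetra, tetraVertex, cons_apply]
      try norm_num
  nlinarith [norm_nonneg (tetra i - tetra j)]

lemma norm_tetra_le (i : Fin 4) : ‖tetra i‖ ≤ 1 := by
  by_cases h : i = 0
  · subst h; simp [tetra]
  · have := norm_tetra_sub h
    simp only [tetra, Fin.cons_zero, sub_zero] at this ⊢
    exact this.le

/-- First ends of the six edges. -/
def edgeSrc : Fin 6 → Fin 4 := ![0, 0, 0, 1, 1, 2]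

/-- Second ends of the six edges. -/
def edgeTgt : Fin 6 → Fin 4 := ![1, 2, 3, 2, 3, 3]

/-- Vertex `i` as a linear function of the three vertices other than the origin. -/
def vertexL : Fin 4 → ((Fin 3 → Pos) →L[ℝ] Pos) :=
  Fin.cons 0 fun i => ContinuousLinearMap.proj i

lemma vertexL_apply (i : Fin 4) (z : Fin 3 → Pos) :
    vertexL i z = (Fin.cons 0 z : Fin 4 → Pos) i := by
  refine Fin.cases ?_ (fun i => ?_) i <;> simp [vertexL]

lemma norm_vertexL_le (i : Fin 4) (z : Fin 3 → Pos) : ‖vertexL i z‖ ≤ ‖z‖ := by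
  rw [vertexL_apply]
  refine Fin.cases ?_ (fun i => ?_) i
  · simp
  · simpa using norm_le_pi_norm z i

/-- The edge vector as a linear function of the vertices. -/
def edgeL (e : Fin 6) : (Fin 3 → Pos) →L[ℝ] Pos := vertexL (edgeTgt e) - vertexL (edgeSrc e)

/-- The derivative of the squared edge lengths at the regular tetrahedron. -/
def edgeDeriv : (Fin 3 → Pos) →L[ℝ] (Fin 6 → ℝ) :=
  ContinuousLinearMap.pi fun e =>
    2 • (innerSL ℝ (edgeL e tetraVertex)).comp (edgeL e)

lemma hasStrictFDerivAt_edge :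
    HasStrictFDerivAt (fun z e => ‖edgeL e z‖ ^ 2) edgeDeriv tetraVertex := by
  rw [edgeDeriv, hasStrictFDerivAt_pi]
  intro e
  exact (hasStrictFDerivAt_norm_sq (edgeL e tetraVertex)).comp tetraVertex
    (edgeL e).hasStrictFDerivAt

lemma surjective_edgeDeriv : Function.Surjective edgeDeriv := by
  intro c
  let t (α β γ : ℝ) : Pos := √2 • !₂[(α + β - γ) / 2, (α - β + γ) / 2, (-α + β + γ) / 2]
  refine ⟨![t (c 0 / 2) ((c 0 + c 1 - c 3) / 4) ((c 0 + c 2 - c 4) / 4),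
    t ((c 0 + c 1 - c 3) / 4) (c 1 / 2) ((c 1 + c 2 - c 5) / 4),
    t ((c 0 + c 2 - c 4) / 4) ((c 1 + c 2 - c 5) / 4) (c 2 / 2)], ?_⟩
  ext e
  fin_cases e <;>
    simp [edgeDeriv, edgeL, vertexL_apply, edgeSrc, edgeTgt, tetraVertex, t,
      PiLp.inner_apply, Fin.sum_univ_three, cons_apply] <;>
    ring

/-- A small perturbation of the squared distance admits equilateral tetrahedra with one vertex at the
origin near the regular one. -/
theorem exists_perturbed_tetrahedron {η : ℝ} (hη : 0 < η) :
    ∃ κ : ℝ, 0 < κ ∧ ∀ (P : Pos × Pos → ℝ) (ν : ℝ),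
      BddLip κ (Metric.ball 0 (5 / 4) ×ˢ Metric.ball 0 (5 / 4)) P → |ν| ≤ κ →
      ∃ q : Fin 4 → Pos, q 0 = 0 ∧ (∀ i, ‖q i - tetra i‖ ≤ η) ∧ (∀ i, ‖q i - tetra i‖ ≤ 1 / 8) ∧
        ∀ i j, i < j → ‖q j - q i‖ ^ 2 + P (q i, q j) = 1 + ν := by
  have hsurj : edgeDeriv.range = ⊤ := LinearMap.range_eq_top.2 surjective_edgeDeriv
  set R := edgeDeriv.nonlinearRightInverseOfSurjective hsurj with hR
  have hR0 : 0 < R.nnnorm := edgeDeriv.nonlinearRightInverseOfSurjective_nnnorm_pos hsurj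
  set c : NNReal := R.nnnorm⁻¹ / 4 with hc
  have hc0 : 0 < c := by positivity
  obtain ⟨s, hs, happ⟩ := hasStrictFDerivAt_edge.approximates_deriv_on_nhds (Or.inr hc0)
  obtain ⟨ρ₀, hρ₀, hρs⟩ := Metric.nhds_basis_closedBall.mem_iff.1 hs
  set ρ := min ρ₀ (min η (1 / 8)) with hρ
  have hρ0 : 0 < ρ := lt_min hρ₀ (lt_min hη (by norm_num))
  refine ⟨min c (c * ρ), lt_min hc0 (by positivity), fun P ν hP hν => ?_⟩
  set κ : ℝ := min (c : ℝ) (c * ρ) with hκ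
  let p : Fin 6 → (Fin 3 → Pos) → Pos × Pos := fun e z =>
    (vertexL (edgeSrc e) z, vertexL (edgeTgt e) z)
  have hball : ∀ z ∈ Metric.closedBall tetraVertex ρ, ∀ i, ‖vertexL i z - tetra i‖ ≤ ρ := by
    intro z hz i
    rw [mem_closedBall_iff_norm] at hz
    have h := (norm_vertexL_le i (z - tetraVertex)).trans hz
    rwa [map_sub, vertexL_apply i tetraVertex] at h
  have hv : ∀ z ∈ Metric.closedBall tetraVertex ρ, ∀ i,
      vertexL i z ∈ Metric.ball (0 : Pos) (5 / 4) := by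
    intro z hz i
    have h1 := norm_add_le (vertexL i z - tetra i) (tetra i)
    rw [sub_add_cancel] at h1
    rw [mem_ball_zero_iff]
    have : ρ ≤ 1 / 8 := (min_le_right _ _).trans (min_le_right _ _)
    linarith [hball z hz i, norm_tetra_le i]
  have hp : ∀ e, MapsTo (p e) (Metric.closedBall tetraVertex ρ)
      (Metric.ball 0 (5 / 4) ×ˢ Metric.ball 0 (5 / 4)) := fun e z hz => ⟨hv z hz _, hv z hz _⟩
  have happ' : ApproximatesLinearOn (fun z e => ‖edgeL e z‖ ^ 2 + P (p e z)) edgeDeriv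
      (Metric.closedBall tetraVertex ρ) (c + c) := by
    intro z hz z' hz'
    have hsub : Metric.closedBall tetraVertex ρ ⊆ s :=
      (Metric.closedBall_subset_closedBall (min_le_left _ _)).trans hρs
    have h1 := happ z (hsub hz) z' (hsub hz')
    have h2 : ‖(fun e => P (p e z)) - fun e => P (p e z')‖ ≤ c * ‖z - z'‖ := by
      rw [pi_norm_le_iff_of_nonneg (by positivity)]
      intro e
      refine (hP.2 _ (hp e hz) _ (hp e hz')).trans ?_
      refine mul_le_mul (min_le_left _ _) ?_ dist_nonneg c.2
      rw [Prod.dist_eq, dist_eq_norm, dist_eq_norm, ← map_sub, ← map_sub]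
      exact max_le (norm_vertexL_le _ _) (norm_vertexL_le _ _)
    have h3 := norm_add_le _ _ |>.trans (add_le_add h1 h2)
    rw [NNReal.coe_add, add_mul]
    refine le_of_eq_of_le (congrArg _ ?_) h3
    ext e
    simp only [Pi.sub_apply, Pi.add_apply]
    ring
  have hmem : (fun _ => 1 + ν : Fin 6 → ℝ) ∈ Metric.closedBall
      (fun e => ‖edgeL e tetraVertex‖ ^ 2 + P (p e tetraVertex))
      (((R.nnnorm : ℝ)⁻¹ - (c + c : NNReal)) * ρ) := by
    have hcR : (R.nnnorm : ℝ)⁻¹ = 4 * c := by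
      rw [hc]; push_cast; ring
    rw [hcR, NNReal.coe_add, mem_closedBall_iff_norm, pi_norm_le_iff_of_nonneg]
    · intro e
      have hz : tetraVertex ∈ Metric.closedBall tetraVertex ρ := Metric.mem_closedBall_self hρ0.le
      have h1 := hP.1 _ (hp e hz)
      have h2 : ‖edgeL e tetraVertex‖ = 1 := by
        rw [edgeL, sub_apply, vertexL_apply, vertexL_apply]
        exact norm_tetra_sub (by fin_cases e <;> decide)
      have h3 : κ ≤ c * ρ := min_le_right _ _
      rw [Pi.sub_apply, h2, Real.norm_eq_abs,
        show 1 + ν - (1 ^ 2 + P (p e tetraVertex)) = ν - P (p e tetraVertex) by ring]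
      refine (abs_sub _ _).trans ?_
      linarith
    · have := c.2
      have : (4 * c - (c + c) : ℝ) = 2 * c := by ring
      rw [this]; positivity
  obtain ⟨z, hz, hzeq⟩ := happ'.surjOn_closedBall_of_nonlinearRightInverse R hρ0.le subset_rfl hmem
  refine ⟨fun i => vertexL i z, by simp [vertexL], fun i => (hball z hz i).trans
    ((min_le_right _ _).trans (min_le_left _ _)), fun i => (hball z hz i).trans
    ((min_le_right _ _).trans (min_le_right _ _)), fun i j hij => ?_⟩
  obtain ⟨e, rfl, rfl⟩ : ∃ e, edgeSrc e = i ∧ edgeTgt e = j := by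
    revert i j; decide
  exact congrFun hzeq e

end Tetrahedron

lemma continuous_spacePart : Continuous spacePart := by
  unfold spacePart; fun_prop

lemma isOpen_cylinder {B : Set Pos} (hB : IsOpen B) : IsOpen (cylinder B) :=
  hB.preimage continuous_spacePart

lemma spacePart_apply (x : Event) (i : Fin 3) : spacePart x i = x i.succ := rfl

/-- The event at time `t` and position `q`. -/
def event (t : ℝ) (q : Pos) : Event := Fin.cons t fun i => q i

@[simp] lemma event_zero (t : ℝ) (q : Pos) : event t q 0 = t := rfl

@[simp] lemma event_succ (t : ℝ) (q : Pos) (i : Fin 3) : event t q i.succ = q i := rfl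

@[simp] lemma spacePart_event (t : ℝ) (q : Pos) : spacePart (event t q) = q := rfl

lemma event_spacePart (x : Event) : event (x 0) (spacePart x) = x := by
  ext i; refine Fin.cases rfl (fun _ => rfl) i

lemma pd_congr {f g : Event → ℝ} {U : Set Event} (hU : IsOpen U) (h : EqOn f g U) {x : Event}
    (hx : x ∈ U) (k : Fin 4) : pd k f x = pd k g x := by
  rw [pd, pd, (h.eventuallyEq_of_mem (hU.mem_nhds hx)).fderiv_eq]

namespace StaticSpacetime

variable (S : StaticSpacetime) {x y : Event}

lemma isOpen_cyl : IsOpen (cylinder S.space) := isOpen_cylinder S.isOpen_space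

lemma metric_succ_zero (hx : x ∈ cylinder S.space) (i : Fin 3) : S.metric x i.succ 0 = 0 := by
  rw [S.symm x hx, S.mixed_zero x hx]

lemma isUnit_det_metric (hx : x ∈ cylinder S.space) : IsUnit (S.metric x).det := by
  rw [isUnit_iff_ne_zero]
  intro h
  obtain ⟨v, hv, hgv⟩ := Matrix.exists_mulVec_eq_zero_iff.2 h
  have h0 : v 0 = 0 := by
    have := congrFun hgv 0
    simp only [Matrix.mulVec, dotProduct, Fin.sum_univ_succ (n := 3), S.mixed_zero x hx,
      zero_mul, Finset.sum_const_zero, add_zero, Pi.zero_apply, mul_eq_zero] at this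
    exact this.resolve_left (S.time_neg x hx).ne
  by_cases hw : (fun i : Fin 3 => v i.succ) = 0
  · exact hv (funext fun i => Fin.cases h0 (fun i => congrFun hw i) i)
  · have hpos := S.space_pos x hx _ hw
    refine hpos.ne' (Finset.sum_eq_zero fun i _ => ?_)
    have := congrFun hgv i.succ
    simp only [Matrix.mulVec, dotProduct, Fin.sum_univ_succ (n := 3), h0, mul_zero, zero_add,
      Pi.zero_apply] at this
    calc _ = v i.succ * ∑ j : Fin 3, S.metric x i.succ j.succ * v j.succ := by
          rw [Finset.mul_sum]
          exact Finset.sum_congr rfl fun j _ => by ring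
      _ = 0 := by rw [this, mul_zero]

lemma metric_mul_inv (hx : x ∈ cylinder S.space) : S.metric x * (S.metric x)⁻¹ = 1 :=
  Matrix.mul_nonsing_inv _ (S.isUnit_det_metric hx)

lemma inv_mul_metric (hx : x ∈ cylinder S.space) : (S.metric x)⁻¹ * S.metric x = 1 :=
  Matrix.nonsing_inv_mul _ (S.isUnit_det_metric hx)

/-- The Christoffel symbols of the first kind. -/
lemma sum_metric_mul_christoffel (hx : x ∈ cylinder S.space) (m i j : Fin 4) :
    ∑ k, S.metric x m k * S.christoffel k i j x =
      (1 / 2) * (pd i (fun y => S.metric y j m) x + pd j (fun y => S.metric y i m) x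
        - pd m (fun y => S.metric y i j) x) := by
  have key : ∀ d : Fin 4 → ℝ, ∑ k, S.metric x m k * ((1 / 2) * ∑ l, (S.metric x)⁻¹ k l * d l) =
      (1 / 2) * d m := fun d => by
    have h : (S.metric x).mulVec ((S.metric x)⁻¹.mulVec d) = d := by
      rw [Matrix.mulVec_mulVec, S.metric_mul_inv hx, Matrix.one_mulVec]
    conv_rhs => rw [← h]
    simp only [Matrix.mulVec, dotProduct, Finset.mul_sum]
    refine Finset.sum_congr rfl fun k _ => Finset.sum_congr rfl fun l _ => ?_
    ring
  exact key _

lemma pd_symm (hx : x ∈ cylinder S.space) (k i j : Fin 4) :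
    pd k (fun y => S.metric y i j) x = pd k (fun y => S.metric y j i) x :=
  pd_congr S.isOpen_cyl (fun y hy => S.symm y hy i j) hx k

lemma pd_mixed (hx : x ∈ cylinder S.space) (k : Fin 4) (i : Fin 3) :
    pd k (fun y => S.metric y 0 i.succ) x = 0 := by
  rw [pd_congr S.isOpen_cyl (g := fun _ => 0) (fun y hy => S.mixed_zero y hy i) hx k]
  simp [pd]

lemma pd_mixed' (hx : x ∈ cylinder S.space) (k : Fin 4) (i : Fin 3) :
    pd k (fun y => S.metric y i.succ 0) x = 0 := by
  rw [S.pd_symm hx, S.pd_mixed hx]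

lemma metric_eq (hx : x ∈ cylinder S.space) (h : spacePart x = spacePart y) :
    S.metric x = S.metric y := S.time_independent x hx y h

lemma pd_eq (hx : x ∈ cylinder S.space) (h : spacePart x = spacePart y) (k i j : Fin 4) :
    pd k (fun z => S.metric z i j) x = pd k (fun z => S.metric z i j) y := by
  have hxy : x = y + (x - y) := by abel
  have hs : ∀ z, spacePart (z + (x - y)) = spacePart z := fun z => by
    ext i
    have := congrArg (fun q : Pos => q i) h
    simp only [spacePart_apply] at this
    simp [spacePart_apply, this]
  have hy : y ∈ cylinder S.space := by
    change spacePart y ∈ S.space; rw [← h]; exact hx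
  rw [pd_congr S.isOpen_cyl (g := fun z => S.metric (z + (x - y)) i j)
    (fun z hz => by simp only [S.metric_eq hz (hs z).symm]) hy, pd, pd,
    fderiv_comp_add_right (f := fun z => S.metric z i j) (x - y), ← hxy]

lemma christoffel_eq (hx : x ∈ cylinder S.space) (h : spacePart x = spacePart y) (k i j : Fin 4) :
    S.christoffel k i j x = S.christoffel k i j y := by
  simp only [christoffel, S.metric_eq hx h, S.pd_eq hx h]

lemma differentiableAt_metric (hx : x ∈ cylinder S.space) (i j : Fin 4) :
    DifferentiableAt ℝ (fun y => S.metric y i j) x :=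
  ((S.smooth i j).contDiffAt (S.isOpen_cyl.mem_nhds hx)).differentiableAt (by simp)

lemma pd_zero (hx : x ∈ cylinder S.space) (i j : Fin 4) :
    pd 0 (fun y => S.metric y i j) x = 0 := by
  have h1 : HasDerivAt (fun t : ℝ => x + t • (Pi.single 0 1 : Event)) (Pi.single 0 1) 0 := by
    simpa using ((hasDerivAt_id (0 : ℝ)).smul_const (Pi.single 0 1 : Event)).const_add x
  have h2 : HasFDerivAt (fun y => S.metric y i j) (fderiv ℝ (fun y => S.metric y i j) x)
      (x + (0 : ℝ) • (Pi.single 0 1 : Event)) := by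
    simpa using (S.differentiableAt_metric hx i j).hasFDerivAt
  have h3 := h2.comp_hasDerivAt (0 : ℝ) h1
  have h4 : (fun y => S.metric y i j) ∘ (fun t : ℝ => x + t • (Pi.single 0 1 : Event)) =
      fun _ => S.metric x i j := by
    funext t
    simp only [Function.comp]
    rw [← S.metric_eq hx]
    ext k
    simp [spacePart_apply]
  rw [h4] at h3
  exact h3.unique (hasDerivAt_const _ _)

lemma inv_metric_succ_zero (hx : x ∈ cylinder S.space) (k : Fin 3) :
    (S.metric x)⁻¹ k.succ 0 = 0 := by
  have := congrFun (congrFun (S.inv_mul_metric hx) k.succ) 0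
  rw [Matrix.mul_apply, Fin.sum_univ_succ] at this
  simp only [S.metric_succ_zero hx, mul_zero, Finset.sum_const_zero, add_zero,
    Matrix.one_apply_ne (Fin.succ_ne_zero k), mul_eq_zero] at this
  exact this.resolve_right (S.time_neg x hx).ne

lemma christoffel_mixed (hx : x ∈ cylinder S.space) (k i : Fin 3) :
    S.christoffel k.succ 0 i.succ x = 0 ∧ S.christoffel k.succ i.succ 0 x = 0 := by
  constructor <;>
  · simp only [christoffel, Fin.sum_univ_succ (n := 3), S.inv_metric_succ_zero hx, S.pd_zero hx,
      S.pd_mixed hx, S.pd_mixed' hx]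
    simp

/-- `g` along a curve. -/
lemma hasDerivWithinAt_metric {γ : ℝ → Event} {v : Event} {s : ℝ} {I : Set ℝ}
    (hγ : HasDerivWithinAt γ v I s) (hs : γ s ∈ cylinder S.space) (i j : Fin 4) :
    HasDerivWithinAt (fun s => S.metric (γ s) i j)
      (∑ k, pd k (fun y => S.metric y i j) (γ s) * v k) I s := by
  refine ((S.differentiableAt_metric hs i j).hasFDerivAt.comp_hasDerivWithinAt s hγ).congr_deriv ?_
  conv_lhs => rw [pi_eq_sum_univ' v, map_sum]
  refine Finset.sum_congr rfl fun k _ => ?_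
  rw [map_smul, smul_eq_mul, mul_comm]
  rfl

lemma sum_metric_mul_acceleration (hx : x ∈ cylinder S.space) (v : Event) (m : Fin 4) :
    ∑ k, S.metric x m k * (-∑ i, ∑ j, S.christoffel k i j x * v i * v j) =
      (1 / 2) * ∑ i, ∑ j, pd m (fun y => S.metric y i j) x * v i * v j -
        ∑ i, ∑ j, pd i (fun y => S.metric y m j) x * v i * v j := by
  have h1 : ∑ k, S.metric x m k * (-∑ i, ∑ j, S.christoffel k i j x * v i * v j) =
      -∑ i, ∑ j, (∑ k, S.metric x m k * S.christoffel k i j x) * v i * v j := by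
    simp only [Finset.mul_sum, Finset.sum_mul, mul_neg, Finset.sum_neg_distrib]
    rw [Finset.sum_comm]
    congr 1
    refine Finset.sum_congr rfl fun i _ => ?_
    rw [Finset.sum_comm]
    refine Finset.sum_congr rfl fun j _ => Finset.sum_congr rfl fun k _ => ?_
    ring
  have h2 : ∑ i, ∑ j, pd j (fun y => S.metric y i m) x * v i * v j =
      ∑ i, ∑ j, pd i (fun y => S.metric y m j) x * v i * v j := by
    rw [Finset.sum_comm]
    refine Finset.sum_congr rfl fun i _ => Finset.sum_congr rfl fun j _ => ?_
    rw [S.pd_symm hx]; ring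
  have h3 : ∑ i, ∑ j, pd i (fun y => S.metric y j m) x * v i * v j =
      ∑ i, ∑ j, pd i (fun y => S.metric y m j) x * v i * v j :=
    Finset.sum_congr rfl fun i _ => Finset.sum_congr rfl fun j _ => by rw [S.pd_symm hx]
  rw [h1]
  simp only [S.sum_metric_mul_christoffel hx]
  have h4 : ∑ i, ∑ j, 1 / 2 * (pd i (fun y => S.metric y j m) x + pd j (fun y => S.metric y i m) x -
      pd m (fun y => S.metric y i j) x) * v i * v j =
      (1 / 2) * (∑ i, ∑ j, pd i (fun y => S.metric y j m) x * v i * v j) +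
      (1 / 2) * (∑ i, ∑ j, pd j (fun y => S.metric y i m) x * v i * v j) -
      (1 / 2) * ∑ i, ∑ j, pd m (fun y => S.metric y i j) x * v i * v j := by
    simp only [Finset.mul_sum, ← Finset.sum_add_distrib, ← Finset.sum_sub_distrib]
    refine Finset.sum_congr rfl fun i _ => Finset.sum_congr rfl fun j _ => ?_
    ring
  rw [h4, h2, h3]
  ring

end StaticSpacetime

lemma eq_of_hasDerivWithinAt_zero {f : ℝ → ℝ}
    (hf : ∀ s ∈ Icc (0 : ℝ) 1, HasDerivWithinAt f 0 (Icc 0 1) s) {s : ℝ} (hs : s ∈ Icc (0 : ℝ) 1) :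
    f s = f 0 := by
  have := (convex_Icc (0 : ℝ) 1).norm_image_sub_le_of_norm_hasDerivWithin_le (C := 0) hf (by simp)
    (left_mem_Icc.2 zero_le_one) hs
  rw [zero_mul, norm_le_zero_iff, sub_eq_zero] at this
  exact this

namespace StaticSpacetime

variable (S : StaticSpacetime) {x y : Event}

lemma inner_self (hx : x ∈ cylinder S.space) (v : Event) :
    S.inner x v v = S.metric x 0 0 * v 0 ^ 2 +
      ∑ i : Fin 3, ∑ j : Fin 3, S.metric x i.succ j.succ * v i.succ * v j.succ := by
  simp only [inner, Fin.sum_univ_succ (n := 3), S.mixed_zero x hx, S.metric_succ_zero hx]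
  simp
  ring

lemma inner_time (hx : x ∈ cylinder S.space) (v : Event) :
    S.inner x v (Pi.single 0 1) = S.metric x 0 0 * v 0 := by
  simp [inner, Fin.sum_univ_succ (n := 3), S.metric_succ_zero hx]

/-- The coefficients of the equation for the spatial paths of null geodesics. -/
def opticalCoeff (k i j : Fin 3) (x : Event) : ℝ :=
  S.christoffel k.succ 0 0 x * (S.metric x i.succ j.succ * (-S.metric x 0 0)⁻¹) +
    S.christoffel k.succ i.succ j.succ x

lemma null_acceleration (hx : x ∈ cylinder S.space) {v : Event} (hv : S.inner x v v = 0)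
    (k : Fin 3) : -∑ i, ∑ j, S.christoffel k.succ i j x * v i * v j =
      -∑ i : Fin 3, ∑ j : Fin 3, S.opticalCoeff k i j x * (v i.succ * v j.succ) := by
  have h0 := S.time_neg x hx
  rw [S.inner_self hx] at hv
  have h1 : v 0 ^ 2 = (-S.metric x 0 0)⁻¹ *
      ∑ i : Fin 3, ∑ j : Fin 3, S.metric x i.succ j.succ * v i.succ * v j.succ := by
    rw [eq_inv_mul_iff_mul_eq₀ (neg_ne_zero.2 h0.ne)]
    linarith
  have h2 : ∑ i, ∑ j, S.christoffel k.succ i j x * v i * v j =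
      S.christoffel k.succ 0 0 x * v 0 ^ 2 +
      ∑ i : Fin 3, ∑ j : Fin 3, S.christoffel k.succ i.succ j.succ x * v i.succ * v j.succ := by
    simp only [Fin.sum_univ_succ (n := 3), (S.christoffel_mixed hx k _).1,
      (S.christoffel_mixed hx k _).2]
    simp
    ring
  rw [h2, h1]
  simp only [opticalCoeff, Finset.mul_sum, ← Finset.sum_add_distrib]
  congr 1
  refine Finset.sum_congr rfl fun i _ => Finset.sum_congr rfl fun j _ => ?_
  ring

lemma hasDerivWithinAt_inner {γ v : ℝ → Event} {a : Event} {s : ℝ} {I : Set ℝ}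
    (hγ : HasDerivWithinAt γ (v s) I s) (hv : HasDerivWithinAt v a I s)
    (hs : γ s ∈ cylinder S.space) :
    HasDerivWithinAt (fun s => S.inner (γ s) (v s) (v s))
      (2 * ∑ i, ∑ j, S.metric (γ s) i j * v s i *
        (a j - -∑ k, ∑ l, S.christoffel j k l (γ s) * v s k * v s l)) I s := by
  have hvi := fun i => (hasDerivWithinAt_pi.1 hv) i
  have h := HasDerivWithinAt.fun_sum (u := Finset.univ) fun (i : Fin 4) _ =>
    HasDerivWithinAt.fun_sum (u := Finset.univ) fun (j : Fin 4) _ =>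
      ((S.hasDerivWithinAt_metric hγ hs i j).mul (hvi i)).mul (hvi j)
  refine h.congr_deriv ?_
  have h1 := fun i => S.sum_metric_mul_acceleration hs (v s) i
  have h2 : ∑ i, ∑ j, S.metric (γ s) i j * v s i *
        (a j - -∑ k, ∑ l, S.christoffel j k l (γ s) * v s k * v s l) =
      ∑ i, ∑ j, S.metric (γ s) i j * v s i * a j -
        ∑ i, v s i * ∑ j, S.metric (γ s) i j *
          (-∑ k, ∑ l, S.christoffel j k l (γ s) * v s k * v s l) := by
    simp only [Finset.mul_sum, ← Finset.sum_sub_distrib]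
    refine Finset.sum_congr rfl fun i _ => Finset.sum_congr rfl fun j _ => ?_
    simp only [mul_sub, Finset.mul_sum, ← Finset.sum_neg_distrib]
    congr 1
    refine Finset.sum_congr rfl fun k _ => Finset.sum_congr rfl fun l _ => ?_
    ring
  have h3 : ∑ i, v s i * ∑ j, S.metric (γ s) i j *
          (-∑ k, ∑ l, S.christoffel j k l (γ s) * v s k * v s l) =
      -(1 / 2) * ∑ i, ∑ j, (∑ k, pd k (fun y => S.metric y i j) (γ s) * v s k) * v s i * v s j := by
    simp only [h1, mul_sub, Finset.sum_sub_distrib]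
    have e1 : ∑ i, v s i * (1 / 2 * ∑ k, ∑ j, pd i (fun y => S.metric y k j) (γ s) * v s k * v s j) =
        1 / 2 * ∑ i, ∑ j, (∑ k, pd k (fun y => S.metric y i j) (γ s) * v s k) * v s i * v s j := by
      simp only [Finset.mul_sum, Finset.sum_mul]
      rw [Finset.sum_comm]
      refine Finset.sum_congr rfl fun i _ => ?_
      rw [Finset.sum_comm]
      refine Finset.sum_congr rfl fun j _ => Finset.sum_congr rfl fun k _ => ?_
      ring
    have e2 : ∑ i, v s i * ∑ k, ∑ j, pd k (fun y => S.metric y i j) (γ s) * v s k * v s j =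
        ∑ i, ∑ j, (∑ k, pd k (fun y => S.metric y i j) (γ s) * v s k) * v s i * v s j := by
      simp only [Finset.mul_sum, Finset.sum_mul]
      refine Finset.sum_congr rfl fun i _ => ?_
      rw [Finset.sum_comm]
      refine Finset.sum_congr rfl fun j _ => Finset.sum_congr rfl fun k _ => ?_
      ring
    rw [e1, e2]; ring
  have h4 : ∑ i, ∑ j, S.metric (γ s) i j * v s i * a j = ∑ i, ∑ j, S.metric (γ s) i j * a i * v s j := by
    rw [Finset.sum_comm]
    refine Finset.sum_congr rfl fun i _ => Finset.sum_congr rfl fun j _ => ?_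
    rw [S.symm _ hs]; ring
  rw [h2, h3]
  have h5 : ∀ X Y Z : ℝ, 2 * (Z - -(1 / 2) * X) = X + Z + Z := fun X Y Z => by ring
  rw [h5 _ 0]
  nth_rewrite 1 [h4]
  simp only [← Finset.sum_add_distrib]
  refine Finset.sum_congr rfl fun i _ => Finset.sum_congr rfl fun j _ => ?_
  simp only [Pi.mul_apply]
  ring

/-- The time translation symmetry yields a conserved quantity. -/
lemma IsNullGeodesic.time_component {S : StaticSpacetime} {V : Set Event} {γ v : ℝ → Event}
    (h : S.IsNullGeodesic V γ v) (hV : V ⊆ cylinder S.space) {s : ℝ} (hs : s ∈ Icc (0 : ℝ) 1) :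
    S.metric (γ s) 0 0 * v s 0 = S.metric (γ 0) 0 0 * v 0 0 := by
  refine eq_of_hasDerivWithinAt_zero (f := fun s => S.metric (γ s) 0 0 * v s 0) (fun r hr => ?_) hs
  have hx := hV (h.mem r hr)
  have hv := (hasDerivWithinAt_pi.1 (h.geodesic r hr)) 0
  refine ((S.hasDerivWithinAt_metric (h.velocity r hr) hx 0 0).mul hv).congr_deriv ?_
  have h1 := S.sum_metric_mul_acceleration hx (v r) 0
  rw [Fin.sum_univ_succ] at h1
  simp only [S.mixed_zero _ hx, zero_mul, Finset.sum_const_zero, add_zero, S.pd_zero hx,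
    mul_zero, zero_sub] at h1
  rw [h1, Finset.sum_mul, ← sub_eq_add_neg, sub_eq_zero]
  refine Finset.sum_congr rfl fun i _ => ?_
  rw [Fin.sum_univ_succ]
  simp [S.pd_mixed hx]

/-- Reversal of the affine parameter exchanges future-pointing and past-pointing geodesics. -/
lemma IsNullGeodesic.reverse {S : StaticSpacetime} {V : Set Event} {γ v : ℝ → Event}
    (h : S.IsNullGeodesic V γ v) :
    S.IsNullGeodesic V (fun s => γ (1 - s)) (fun s => -v (1 - s)) := by
  have hm : MapsTo (fun s : ℝ => 1 - s) (Icc 0 1) (Icc 0 1) := fun s hs =>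
    ⟨by linarith [hs.2], by linarith [hs.1]⟩
  have hd : ∀ s ∈ Icc (0 : ℝ) 1, HasDerivWithinAt (fun s : ℝ => 1 - s) (-1) (Icc 0 1) s :=
    fun s _ => by simpa using (hasDerivWithinAt_id s _).const_sub 1
  refine ⟨fun s hs => h.mem _ (hm hs), fun s hs => ?_, fun s hs => ?_, fun s hs => ?_⟩
  · exact ((h.velocity _ (hm hs)).scomp s (hd s hs) hm).congr_deriv (by simp)
  · refine ((h.geodesic _ (hm hs)).scomp s (hd s hs) hm).neg.congr_deriv ?_
    ext k
    simp
  · simpa [inner] using h.null _ (hm hs)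

lemma isPast_iff_isFuture_reverse {V : Set Event} {γ : ℝ → Event} :
    S.IsPastNullGeodesic V γ ↔ S.IsFutureNullGeodesic V fun s => γ (1 - s) := by
  have hm : ∀ s ∈ Icc (0 : ℝ) 1, 1 - s ∈ Icc (0 : ℝ) 1 := fun s hs =>
    ⟨by linarith [hs.2], by linarith [hs.1]⟩
  constructor
  · rintro ⟨v, h, hp⟩
    refine ⟨_, h.reverse, fun s hs => ?_⟩
    have := hp _ (hm s hs)
    simp only [PastPointing, FuturePointing, inner] at *
    simpa using this
  · rintro ⟨v, h, hp⟩
    refine ⟨fun s => -v (1 - s), by simpa using h.reverse, fun s hs => ?_⟩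
    have := hp _ (hm s hs)
    simp only [PastPointing, FuturePointing, inner] at *
    simpa using this

end StaticSpacetime

lemma hasDerivWithinAt_euclidean {f : ℝ → Pos} {f' : Pos} {I : Set ℝ} {s : ℝ} :
    HasDerivWithinAt f f' I s ↔ ∀ i, HasDerivWithinAt (fun s => f s i) (f' i) I s := by
  rw [hasDerivWithinAt_iff_hasFDerivWithinAt, hasFDerivWithinAt_piLp]
  refine forall_congr' fun i => ?_
  rw [hasDerivWithinAt_iff_hasFDerivWithinAt]
  refine iff_of_eq (congrArg (fun l => HasFDerivWithinAt (fun s => f s i) l I s) ?_)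
  ext
  simp

namespace StaticSpacetime

variable (S : StaticSpacetime) (x₁ : Pos) (L : ℝ)

/-- The event at time zero with position `y` in units of `L`, measured from `x₁`. -/
def scaledEvent (y : Pos) : Event := event 0 (x₁ + L • y)

/-- The squared lapse `-g₀₀` in scaled position coordinates. -/
def lapse (y : Pos) : ℝ := -S.metric (scaledEvent x₁ L y) 0 0

/-- The spatial metric in scaled position coordinates. -/
def spatial (i j : Fin 3) (y : Pos) : ℝ := S.metric (scaledEvent x₁ L y) i.succ j.succ

/-- The coefficients of the equation for spatial paths of null geodesics, in scaled position
coordinates. -/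
def scaledCoeff (k i j : Fin 3) (y : Pos) : ℝ := L * S.opticalCoeff k i j (scaledEvent x₁ L y)

/-- The squared length of a spatial vector. -/
def spatialSq (y w : Pos) : ℝ := ∑ i, ∑ j, S.spatial x₁ L i j y * w i * w j

/-- The coordinate time per unit of parameter that light needs with velocity `w` at `y`. -/
def slowness (y w : Pos) : ℝ := √(S.spatialSq x₁ L y w * (S.lapse x₁ L y)⁻¹)

lemma spatialSq_smul (c : ℝ) (y w : Pos) :
    S.spatialSq x₁ L y (c • w) = c ^ 2 * S.spatialSq x₁ L y w := by
  simp only [spatialSq, Finset.mul_sum, PiLp.smul_apply, smul_eq_mul]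
  refine Finset.sum_congr rfl fun i _ => Finset.sum_congr rfl fun j _ => ?_
  ring

lemma slowness_neg (y w : Pos) : S.slowness x₁ L y (-w) = S.slowness x₁ L y w := by
  have := S.spatialSq_smul x₁ L (-1) y w
  simp only [neg_smul, one_smul, even_two, Even.neg_pow, one_pow, one_mul] at this
  rw [slowness, slowness, this]

variable {S x₁ L} {B : Set Pos}

lemma scaled_mem (hL : 0 < L) {y : Pos} :
    x₁ + L • y ∈ Metric.ball x₁ (2 * L) ↔ y ∈ Metric.ball (0 : Pos) 2 := by
  rw [mem_ball_iff_norm, mem_ball_zero_iff, add_sub_cancel_left, norm_smul, Real.norm_eq_abs,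
    abs_of_pos hL, mul_comm, mul_lt_mul_iff_left₀ hL]

lemma scaledEvent_mem (hL : 0 < L) (hB : Metric.ball x₁ (2 * L) ⊆ S.space) {y : Pos}
    (hy : y ∈ Metric.ball (0 : Pos) 2) : scaledEvent x₁ L y ∈ cylinder S.space :=
  hB ((scaled_mem hL).2 hy)

lemma scaledEvent_mem_ball (hL : 0 < L) {y : Pos} (hy : y ∈ Metric.ball (0 : Pos) 2) :
    scaledEvent x₁ L y ∈ cylinder (Metric.ball x₁ (2 * L)) :=
  (scaled_mem hL).2 hy

lemma lapse_pos (hL : 0 < L) (hB : Metric.ball x₁ (2 * L) ⊆ S.space) {y : Pos}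
    (hy : y ∈ Metric.ball (0 : Pos) 2) : 0 < S.lapse x₁ L y :=
  neg_pos.2 (S.time_neg _ (scaledEvent_mem hL hB hy))

lemma spatialSq_pos (hL : 0 < L) (hB : Metric.ball x₁ (2 * L) ⊆ S.space) {y : Pos}
    (hy : y ∈ Metric.ball (0 : Pos) 2) {w : Pos} (hw : w ≠ 0) : 0 < S.spatialSq x₁ L y w :=
  S.space_pos _ (scaledEvent_mem hL hB hy) _ fun h => hw (by ext i; exact congrFun h i)

lemma lapse_mul_slowness_sq (hL : 0 < L) (hB : Metric.ball x₁ (2 * L) ⊆ S.space) {y : Pos}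
    (hy : y ∈ Metric.ball (0 : Pos) 2) (w : Pos) :
    S.lapse x₁ L y * S.slowness x₁ L y w ^ 2 = S.spatialSq x₁ L y w := by
  have hN := lapse_pos hL hB hy
  have h0 : 0 ≤ S.spatialSq x₁ L y w := by
    rcases eq_or_ne w 0 with rfl | hw
    · simp [spatialSq]
    · exact (spatialSq_pos hL hB hy hw).le
  rw [slowness, Real.sq_sqrt (by positivity)]
  field_simp

lemma slowness_pos (hL : 0 < L) (hB : Metric.ball x₁ (2 * L) ⊆ S.space) {y : Pos}
    (hy : y ∈ Metric.ball (0 : Pos) 2) {w : Pos} (hw : w ≠ 0) : 0 < S.slowness x₁ L y w :=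
  Real.sqrt_pos.2 (mul_pos (spatialSq_pos hL hB hy hw) (inv_pos.2 (lapse_pos hL hB hy)))

lemma hasDerivWithinAt_spacePart {γ : ℝ → Event} {v : Event} {s : ℝ} {I : Set ℝ}
    (h : HasDerivWithinAt γ v I s) :
    HasDerivWithinAt (fun s => spacePart (γ s)) (spacePart v) I s :=
  hasDerivWithinAt_euclidean.2 fun i => hasDerivWithinAt_pi.1 h i.succ

lemma hasDerivWithinAt_event {t : ℝ → ℝ} {q : ℝ → Pos} {t' : ℝ} {q' : Pos} {s : ℝ} {I : Set ℝ}
    (ht : HasDerivWithinAt t t' I s) (hq : HasDerivWithinAt q q' I s) :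
    HasDerivWithinAt (fun s => event (t s) (q s)) (event t' q') I s :=
  hasDerivWithinAt_pi.2 fun i => Fin.cases ht (fun i => hasDerivWithinAt_euclidean.1 hq i) i

/-- Inner products at an event in terms of scaled quantities. -/
lemma inner_self_scaled (hL : 0 < L) (hB : Metric.ball x₁ (2 * L) ⊆ S.space) {x : Event} {y : Pos}
    (hy : y ∈ Metric.ball (0 : Pos) 2) (hxy : spacePart x = x₁ + L • y) (t : ℝ) (w : Pos) :
    S.inner x (event t w) (event t w) = -S.lapse x₁ L y * t ^ 2 + S.spatialSq x₁ L y w := by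
  have hx : x ∈ cylinder S.space := by
    change spacePart x ∈ S.space
    rw [hxy]; exact hB ((scaled_mem hL).2 hy)
  rw [S.inner_self hx, S.metric_eq hx (y := scaledEvent x₁ L y) hxy]
  simp [lapse, spatialSq, spatial]

/-- Spatial paths of future-pointing null geodesics. -/
theorem IsNullGeodesic.reduce (hL : 0 < L) (hB : Metric.ball x₁ (2 * L) ⊆ S.space)
    {γ v : ℝ → Event} (h : S.IsNullGeodesic (cylinder (Metric.ball x₁ (2 * L))) γ v)
    (hf : ∀ s ∈ Icc (0 : ℝ) 1, S.FuturePointing (γ s) (v s)) :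
    ∃ y w : ℝ → Pos, (∀ s, spacePart (γ s) = x₁ + L • y s) ∧
      (∀ s ∈ Icc (0 : ℝ) 1, y s ∈ Metric.ball (0 : Pos) 2) ∧
      IsSol (quadAcc (S.scaledCoeff x₁ L)) y w ∧
      ∀ s ∈ Icc (0 : ℝ) 1,
        HasDerivWithinAt (fun s => γ s 0) (L * S.slowness x₁ L (y s) (w s)) (Icc 0 1) s := by
  set y : ℝ → Pos := fun s => L⁻¹ • (spacePart (γ s) - x₁) with hyd
  set w : ℝ → Pos := fun s => L⁻¹ • spacePart (v s) with hwd
  have hγ : ∀ s, spacePart (γ s) = x₁ + L • y s := fun s => by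
    simp [hyd, smul_smul, hL.ne']
  have hv : ∀ s, spacePart (v s) = L • w s := fun s => by
    simp [hwd, smul_smul, hL.ne']
  have hy : ∀ s ∈ Icc (0 : ℝ) 1, y s ∈ Metric.ball (0 : Pos) 2 := fun s hs => by
    rw [← scaled_mem hL (x₁ := x₁), ← hγ]
    exact h.mem s hs
  have hx : ∀ s ∈ Icc (0 : ℝ) 1, γ s ∈ cylinder S.space := fun s hs => hB (h.mem s hs)
  refine ⟨y, w, hγ, hy, ⟨fun s hs => ?_, fun s hs => ?_⟩, fun s hs => ?_⟩
  · exact ((hasDerivWithinAt_spacePart (h.velocity s hs)).sub_const x₁).const_smul L⁻¹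
  · refine ((hasDerivWithinAt_spacePart (h.geodesic s hs)).const_smul L⁻¹).congr_deriv ?_
    ext k
    simp only [PiLp.smul_apply, spacePart_apply, smul_eq_mul, quadAcc,
      S.null_acceleration (hx s hs) (h.null s hs) k, mul_neg, Finset.mul_sum]
    congr 1
    refine Finset.sum_congr rfl fun i _ => Finset.sum_congr rfl fun j _ => ?_
    have e : ∀ i : Fin 3, v s i.succ = L * w s i := fun i => by
      rw [← spacePart_apply (v s) i, hv]; rfl
    have e2 : S.opticalCoeff k i j (γ s) = S.opticalCoeff k i j (scaledEvent x₁ L (y s)) := by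
      have e3 : spacePart (γ s) = spacePart (scaledEvent x₁ L (y s)) := hγ s
      simp only [opticalCoeff, S.metric_eq (hx s hs) e3, S.christoffel_eq (hx s hs) e3]
    rw [e, e, scaledCoeff, e2]
    field_simp
  · refine (hasDerivWithinAt_pi.1 (h.velocity s hs) 0).congr_deriv ?_
    have h1 := h.null s hs
    rw [← event_spacePart (v s), inner_self_scaled hL hB (hy s hs) (hγ s), hv, spatialSq_smul,
      ← lapse_mul_slowness_sq hL hB (hy s hs)] at h1
    have hN := lapse_pos hL hB (hy s hs)
    have h2 : v s 0 ^ 2 = (L * S.slowness x₁ L (y s) (w s)) ^ 2 :=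
      mul_left_cancel₀ hN.ne' (by linarith)
    have h3 := hf s hs
    rw [FuturePointing, S.inner_time (hx s hs)] at h3
    have h4 : 0 < v s 0 := by
      by_contra! h5
      exact absurd h3 (not_lt.2 (mul_nonneg_of_nonpos_of_nonpos (S.time_neg _ (hx s hs)).le h5))
    exact (pow_left_inj₀ h4.le (mul_nonneg hL.le (Real.sqrt_nonneg _)) two_ne_zero).1 h2

/-- Null geodesics from spatial paths. -/
theorem isNullGeodesic_of_isSol (hL : 0 < L) (hB : Metric.ball x₁ (2 * L) ⊆ S.space)
    {y w : ℝ → Pos} (hsol : IsSol (quadAcc (S.scaledCoeff x₁ L)) y w)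
    (hy : ∀ s ∈ Icc (0 : ℝ) 1, y s ∈ Metric.ball (0 : Pos) 2)
    (hw : ∀ s ∈ Icc (0 : ℝ) 1, w s ≠ 0) {t : ℝ → ℝ}
    (ht : ∀ s ∈ Icc (0 : ℝ) 1, HasDerivWithinAt t (L * S.slowness x₁ L (y s) (w s)) (Icc 0 1) s) :
    S.IsNullGeodesic (cylinder (Metric.ball x₁ (2 * L))) (fun s => event (t s) (x₁ + L • y s))
      (fun s => event (L * S.slowness x₁ L (y s) (w s)) (L • w s)) := by
  set γ : ℝ → Event := fun s => event (t s) (x₁ + L • y s) with hγ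
  set v : ℝ → Event := fun s => event (L * S.slowness x₁ L (y s) (w s)) (L • w s) with hv
  have hmem : ∀ s ∈ Icc (0 : ℝ) 1, γ s ∈ cylinder (Metric.ball x₁ (2 * L)) := fun s hs =>
    (scaled_mem hL).2 (hy s hs)
  have hx : ∀ s ∈ Icc (0 : ℝ) 1, γ s ∈ cylinder S.space := fun s hs => hB (hmem s hs)
  have hvel : ∀ s ∈ Icc (0 : ℝ) 1, HasDerivWithinAt γ (v s) (Icc 0 1) s := fun s hs =>
    hasDerivWithinAt_event (ht s hs) (((hsol.vel s hs).const_smul L).const_add x₁)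
  have hnull : ∀ s ∈ Icc (0 : ℝ) 1, S.inner (γ s) (v s) (v s) = 0 := fun s hs => by
    rw [inner_self_scaled hL hB (hy s hs) rfl, spatialSq_smul,
      ← lapse_mul_slowness_sq hL hB (hy s hs)]
    ring
  have hpos : ∀ s ∈ Icc (0 : ℝ) 1, 0 < v s 0 := fun s hs =>
    mul_pos hL (slowness_pos hL hB (hy s hs) (hw s hs))
  refine ⟨hmem, hvel, fun s hs => ?_, hnull⟩
  have hspace : ∀ k : Fin 3, HasDerivWithinAt (fun s => v s k.succ)
      (-∑ i, ∑ j, S.christoffel k.succ i j (γ s) * v s i * v s j) (Icc 0 1) s := fun k => by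
    refine ((hasDerivWithinAt_euclidean.1 (hsol.acc s hs) k).const_mul L).congr_deriv ?_
    rw [S.null_acceleration (hx s hs) (hnull s hs) k]
    simp only [quadAcc, mul_neg, Finset.mul_sum]
    congr 1
    refine Finset.sum_congr rfl fun i _ => Finset.sum_congr rfl fun j _ => ?_
    have e3 : spacePart (γ s) = spacePart (scaledEvent x₁ L (y s)) := rfl
    have e2 : S.opticalCoeff k i j (γ s) = S.opticalCoeff k i j (scaledEvent x₁ L (y s)) := by
      simp only [opticalCoeff, S.metric_eq (hx s hs) e3, S.christoffel_eq (hx s hs) e3]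
    rw [scaledCoeff, e2]
    simp only [hv, event_succ, PiLp.smul_apply, smul_eq_mul]
    ring
  have hsq : ∀ r ∈ Icc (0 : ℝ) 1, v r 0 = √((-S.metric (γ r) 0 0)⁻¹ *
      ∑ i : Fin 3, ∑ j : Fin 3, S.metric (γ r) i.succ j.succ * v r i.succ * v r j.succ) := by
    intro r hr
    have h1 := hnull r hr
    have h0 := S.time_neg _ (hx r hr)
    rw [S.inner_self (hx r hr)] at h1
    have h2 : (-S.metric (γ r) 0 0)⁻¹ * ∑ i : Fin 3, ∑ j : Fin 3,
        S.metric (γ r) i.succ j.succ * v r i.succ * v r j.succ = v r 0 ^ 2 := by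
      rw [eq_comm, eq_inv_mul_iff_mul_eq₀ (neg_ne_zero.2 h0.ne)]
      linarith
    rw [h2, Real.sqrt_sq (hpos r hr).le]
  obtain ⟨a, ha⟩ : ∃ a, HasDerivWithinAt (fun s => v s 0) a (Icc 0 1) s := by
    have h1 := HasDerivWithinAt.fun_sum (u := Finset.univ) fun (i : Fin 3) _ =>
      HasDerivWithinAt.fun_sum (u := Finset.univ) fun (j : Fin 3) _ =>
        ((S.hasDerivWithinAt_metric (hvel s hs) (hx s hs) i.succ j.succ).mul (hspace i)).mul
          (hspace j)
    have h2 := ((S.hasDerivWithinAt_metric (hvel s hs) (hx s hs) 0 0).neg.inv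
      (neg_ne_zero.2 (S.time_neg _ (hx s hs)).ne)).mul h1
    have h3 := h2.sqrt (fun h => by
      have := hsq s hs
      simp only [Pi.mul_apply, Pi.inv_apply, Pi.neg_apply] at h
      rw [h, Real.sqrt_zero] at this
      exact (hpos s hs).ne' this)
    exact ⟨_, h3.congr hsq (hsq s hs)⟩
  set acc : Event := fun k => -∑ i, ∑ j, S.christoffel k i j (γ s) * v s i * v s j with hacc
  have hva : HasDerivWithinAt v (Fin.cons a fun k => acc k.succ) (Icc 0 1) s :=
    hasDerivWithinAt_pi.2 fun i => Fin.cases ha (fun i => hspace i) i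
  have hz : HasDerivWithinAt (fun s => S.inner (γ s) (v s) (v s)) 0 (Icc 0 1) s :=
    (hasDerivWithinAt_const s _ (0 : ℝ)).congr hnull (hnull s hs)
  have h5 := ((uniqueDiffOn_Icc zero_lt_one) s hs).eq_deriv _
    (S.hasDerivWithinAt_inner (hvel s hs) hva (hx s hs)) hz
  have h6 : S.metric (γ s) 0 0 * v s 0 * (a - acc 0) = 0 := by
    simp only [Fin.sum_univ_succ (n := 3), S.mixed_zero _ (hx s hs),
      S.metric_succ_zero (hx s hs)] at h5
    simp only [hacc, Fin.sum_univ_succ (n := 3), Fin.cons_zero, Fin.cons_succ] at h5 ⊢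
    simpa using h5
  have h7 : a = acc 0 := by
    rcases mul_eq_zero.1 h6 with h | h
    · exact absurd h (mul_ne_zero (S.time_neg _ (hx s hs)).ne (hpos s hs).ne')
    · linarith
  refine hva.congr_deriv ?_
  ext k
  refine Fin.cases h7 (fun k => rfl) k

lemma isFutureNullGeodesic_of_isSol (hL : 0 < L) (hB : Metric.ball x₁ (2 * L) ⊆ S.space)
    {y w : ℝ → Pos} (hsol : IsSol (quadAcc (S.scaledCoeff x₁ L)) y w)
    (hy : ∀ s ∈ Icc (0 : ℝ) 1, y s ∈ Metric.ball (0 : Pos) 2)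
    (hw : ∀ s ∈ Icc (0 : ℝ) 1, w s ≠ 0) {t : ℝ → ℝ}
    (ht : ∀ s ∈ Icc (0 : ℝ) 1, HasDerivWithinAt t (L * S.slowness x₁ L (y s) (w s)) (Icc 0 1) s) :
    S.IsFutureNullGeodesic (cylinder (Metric.ball x₁ (2 * L)))
      fun s => event (t s) (x₁ + L • y s) := by
  have h := isNullGeodesic_of_isSol hL hB hsol hy hw ht
  refine ⟨_, h, fun s hs => ?_⟩
  have hx := hB (h.mem s hs)
  rw [FuturePointing, S.inner_time hx]
  exact mul_neg_of_neg_of_pos (S.time_neg _ hx)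
    (mul_pos hL (slowness_pos hL hB (hy s hs) (hw s hs)))

lemma lapse_mul_slowness_const (hL : 0 < L) (hB : Metric.ball x₁ (2 * L) ⊆ S.space)
    {y w : ℝ → Pos} (hsol : IsSol (quadAcc (S.scaledCoeff x₁ L)) y w)
    (hy : ∀ s ∈ Icc (0 : ℝ) 1, y s ∈ Metric.ball (0 : Pos) 2)
    (hw : ∀ s ∈ Icc (0 : ℝ) 1, w s ≠ 0) {t : ℝ → ℝ}
    (ht : ∀ s ∈ Icc (0 : ℝ) 1, HasDerivWithinAt t (L * S.slowness x₁ L (y s) (w s)) (Icc 0 1) s)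
    {s : ℝ} (hs : s ∈ Icc (0 : ℝ) 1) :
    S.lapse x₁ L (y s) * S.slowness x₁ L (y s) (w s) =
      S.lapse x₁ L (y 0) * S.slowness x₁ L (y 0) (w 0) := by
  have h := isNullGeodesic_of_isSol hL hB hsol hy hw ht
  have h1 := h.time_component (fun x hx => hB hx) hs
  have e : ∀ r ∈ Icc (0 : ℝ) 1, S.metric (event (t r) (x₁ + L • y r)) 0 0 =
      -S.lapse x₁ L (y r) := fun r hr => by
    rw [S.metric_eq (y := scaledEvent x₁ L (y r)) (hB (h.mem r hr)) rfl, lapse, neg_neg]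
  simp only [event_zero] at h1
  rw [e s hs, e 0 (left_mem_Icc.2 zero_le_one)] at h1
  refine mul_left_cancel₀ hL.ne' ?_
  linarith

end StaticSpacetime

lemma hasDerivWithinAt_comp_pd {f : Event → ℝ} {γ : ℝ → Event} {v : Event} {s : ℝ} {I : Set ℝ}
    (hf : DifferentiableAt ℝ f (γ s)) (hγ : HasDerivWithinAt γ v I s) :
    HasDerivWithinAt (fun s => f (γ s)) (∑ k, pd k f (γ s) * v k) I s := by
  refine (hf.hasFDerivAt.comp_hasDerivWithinAt s hγ).congr_deriv ?_
  conv_lhs => rw [pi_eq_sum_univ' v, map_sum]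
  refine Finset.sum_congr rfl fun k _ => ?_
  rw [map_smul, smul_eq_mul, mul_comm]
  rfl

/-- The inverse of a function near one. -/
lemma BddLip.inv {X : Type*} [PseudoMetricSpace X] {s : Set X} {f : X → ℝ} {κ : ℝ}
    (hf : BddLip κ s fun x => f x - 1) (hκ : κ ≤ 1 / 2) : BddLip (4 * κ) s fun x => (f x)⁻¹ - 1 := by
  have h : ∀ x ∈ s, 1 / 2 ≤ f x := fun x hx => by
    have := (abs_le.1 (hf.1 x hx)).1; linarith
  have h2 : ∀ x ∈ s, |(f x)⁻¹| ≤ 2 := fun x hx => by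
    have h0 : 0 < f x := by linarith [h x hx]
    rw [abs_of_pos (inv_pos.2 h0), inv_le_comm₀ h0 (by norm_num)]
    linarith [h x hx]
  refine ⟨fun x hx => ?_, fun x hx y hy => ?_⟩
  · have h0 : f x ≠ 0 := by linarith [h x hx]
    change |(f x)⁻¹ - 1| ≤ 4 * κ
    rw [show (f x)⁻¹ - 1 = -(f x - 1) * (f x)⁻¹ by field_simp; ring, abs_mul, abs_neg]
    have hκ0 := (abs_nonneg _).trans (hf.1 x hx)
    have := mul_le_mul (hf.1 x hx) (h2 x hx) (abs_nonneg _) hκ0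
    linarith
  · have h0 : f x ≠ 0 := by linarith [h x hx]
    have h1 : f y ≠ 0 := by linarith [h y hy]
    change |(f x)⁻¹ - 1 - ((f y)⁻¹ - 1)| ≤ 4 * κ * dist x y
    rw [show (f x)⁻¹ - 1 - ((f y)⁻¹ - 1) = -((f x - 1) - (f y - 1)) * ((f x)⁻¹ * (f y)⁻¹) by
      field_simp; ring, abs_mul, abs_neg, abs_mul]
    have h3 := hf.2 x hx y hy
    have h4 := mul_le_mul (h2 x hx) (h2 y hy) (abs_nonneg _) zero_le_two
    have := mul_le_mul h3 h4 (by positivity) ((abs_nonneg _).trans h3)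
    linarith

namespace StaticSpacetime

variable {S : StaticSpacetime} {x₁ : Pos} {L ε : ℝ}

lemma abs_scaled_sub_le (hL : 0 < L) (hB : Metric.ball x₁ (2 * L) ⊆ S.space) {f : Event → ℝ}
    (hf : ∀ x ∈ cylinder S.space, DifferentiableAt ℝ f x)
    (hd : ∀ x ∈ cylinder (Metric.ball x₁ (2 * L)), ∀ k, L * |pd k f x| ≤ ε) {y z : Pos}
    (hy : y ∈ Metric.ball (0 : Pos) 2) (hz : z ∈ Metric.ball (0 : Pos) 2) :
    |f (scaledEvent x₁ L y) - f (scaledEvent x₁ L z)| ≤ 3 * ε * dist y z := by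
  let c : ℝ → Pos := fun s => z + s • (y - z)
  have hc : ∀ s ∈ Icc (0 : ℝ) 1, c s ∈ Metric.ball (0 : Pos) 2 := fun s hs => by
    have := (convex_ball (0 : Pos) 2).add_smul_sub_mem hz hy hs
    exact this
  have hcd : ∀ s ∈ Icc (0 : ℝ) 1, HasDerivWithinAt (fun s => scaledEvent x₁ L (c s))
      (event 0 (L • (y - z))) (Icc 0 1) s := fun s _ => by
    have h1 : HasDerivWithinAt c (y - z) (Icc 0 1) s :=
      (((hasDerivWithinAt_id s _).smul_const (y - z)).const_add z).congr_deriv (by simp)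
    exact hasDerivWithinAt_event (hasDerivWithinAt_const _ _ _) ((h1.const_smul L).const_add x₁)
  have hb : ∀ s ∈ Icc (0 : ℝ) 1, ‖∑ k, pd k f (scaledEvent x₁ L (c s)) *
      event 0 (L • (y - z)) k‖ ≤ 3 * ε * dist y z := fun s hs => by
    have hm : scaledEvent x₁ L (c s) ∈ cylinder (Metric.ball x₁ (2 * L)) :=
      scaledEvent_mem_ball hL (hc s hs)
    rw [Fin.sum_univ_succ]
    simp only [event_zero, mul_zero, zero_add, event_succ, PiLp.smul_apply, smul_eq_mul]
    refine (norm_sum_le _ _).trans ((Finset.sum_le_card_nsmul _ _ (ε * dist y z)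
      fun i _ => ?_).trans ?_)
    · rw [Real.norm_eq_abs, show ∀ a b : ℝ, a * (L * b) = (L * a) * b from fun a b => by ring,
        abs_mul, abs_mul, abs_of_pos hL, dist_eq_norm]
      exact mul_le_mul (hd _ hm _) (abs_apply_le_norm (y - z) i) (abs_nonneg _)
        ((mul_nonneg hL.le (abs_nonneg _)).trans (hd _ hm i.succ))
    · simp only [Finset.card_univ, Fintype.card_fin, nsmul_eq_mul, Nat.cast_ofNat]
      linarith
  have := (convex_Icc (0 : ℝ) 1).norm_image_sub_le_of_norm_hasDerivWithin_le
    (fun s hs => hasDerivWithinAt_comp_pd (hf _ (scaledEvent_mem hL hB (hc s hs))) (hcd s hs)) hb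
    (left_mem_Icc.2 zero_le_one) (right_mem_Icc.2 zero_le_one)
  simpa [c] using this

lemma IsGentle.metric (h : S.IsGentle ε x₁ L) (hL : 0 < L) (hε : 0 ≤ ε) (i j : Fin 4) :
    BddLip (3 * ε) (Metric.ball (0 : Pos) 2)
      fun y => S.metric (scaledEvent x₁ L y) i j - minkowski i j := by
  refine ⟨fun y hy => ?_, fun y hy z hz => ?_⟩
  · linarith [(h.2 (scaledEvent x₁ L y) (scaledEvent_mem_ball hL hy) i j).1]
  · rw [sub_sub_sub_cancel_right]
    exact abs_scaled_sub_le hL h.1 (f := fun x => S.metric x i j)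
      (fun x hx => S.differentiableAt_metric hx i j) (fun x hx => (h.2 x hx i j).2.1) hy hz

lemma IsGentle.pd_metric (h : S.IsGentle ε x₁ L) (hL : 0 < L) (hε : 0 ≤ ε) (k i j : Fin 4) :
    BddLip (3 * ε) (Metric.ball (0 : Pos) 2)
      fun y => L * pd k (fun x => S.metric x i j) (scaledEvent x₁ L y) := by
  have hdiff : ∀ x ∈ cylinder S.space,
      DifferentiableAt ℝ (fun x => pd k (fun x => S.metric x i j) x) x := fun x hx => by
    have h1 : ContDiffAt ℝ ∞ (fun x => S.metric x i j) x :=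
      (S.smooth i j).contDiffAt (S.isOpen_cyl.mem_nhds hx)
    have h2 : ContDiffAt ℝ 1 (fderiv ℝ fun x => S.metric x i j) x :=
      h1.fderiv_right (m := 1) (WithTop.coe_le_coe.2 (le_top : (1 + 1 : ℕ∞) ≤ ⊤))
    exact (h2.differentiableAt one_ne_zero).clm_apply (differentiableAt_const _)
  refine ⟨fun y hy => ?_, fun y hy z hz => ?_⟩
  · rw [abs_mul, abs_of_pos hL]
    linarith [(h.2 (scaledEvent x₁ L y) (scaledEvent_mem_ball hL hy) i j).2.1 k]
  · have h1 := abs_scaled_sub_le hL h.1 (ε := ε / L) hdiff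
      (fun x hx l => by
        rw [le_div_iff₀ hL]
        have := (h.2 x hx i j).2.2 l k
        calc _ = _ := by ring
          _ ≤ ε := this) hy hz
    rw [← mul_sub, abs_mul, abs_of_pos hL]
    calc _ ≤ L * _ := mul_le_mul_of_nonneg_left h1 hL.le
      _ = _ := by field_simp

lemma IsGentle.inv_metric (h : S.IsGentle ε x₁ L) (hL : 0 < L) (hε : 0 ≤ ε) (hε1 : ε ≤ 1 / 100)
    (i j : Fin 4) : BddLip 2 (Metric.ball (0 : Pos) 2)
      fun y => (S.metric (scaledEvent x₁ L y))⁻¹ i j := by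
  have hbd : ∀ y ∈ Metric.ball (0 : Pos) 2, ∀ i j, |(S.metric (scaledEvent x₁ L y))⁻¹ i j| ≤ 2 := by
    intro y hy i j
    set g := S.metric (scaledEvent x₁ L y) with hg
    obtain ⟨m, -, hm⟩ := Finset.exists_max_image Finset.univ (fun i => |g⁻¹ i j|) ⟨i, Finset.mem_univ i⟩
    refine (hm i (Finset.mem_univ i)).trans ?_
    have hm' : ∀ k, |g⁻¹ k j| ≤ |g⁻¹ m j| := fun k => hm k (Finset.mem_univ k)
    have h1 := congrFun (congrFun (S.metric_mul_inv (scaledEvent_mem hL h.1 hy)) m) j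
    rw [← hg, Matrix.mul_apply] at h1
    have h2 : ∑ k, minkowski m k * g⁻¹ k j = minkowski m m * g⁻¹ m j :=
      Finset.sum_eq_single m (fun k _ hk => by simp [minkowski, hk.symm]) (by simp)
    have h3 : minkowski m m * g⁻¹ m j =
        (1 : Matrix (Fin 4) (Fin 4) ℝ) m j - ∑ k, (g m k - minkowski m k) * g⁻¹ k j := by
      simp only [sub_mul, Finset.sum_sub_distrib, h1, h2]; ring
    have h4 : |minkowski m m * g⁻¹ m j| = |g⁻¹ m j| := by
      rw [abs_mul, show |minkowski m m| = 1 by simp only [minkowski]; split_ifs <;> simp, one_mul]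
    have h5 : |∑ k, (g m k - minkowski m k) * g⁻¹ k j| ≤ 4 * (ε * |g⁻¹ m j|) := by
      refine (Finset.abs_sum_le_sum_abs _ _).trans ((Finset.sum_le_card_nsmul _ _
        (ε * |g⁻¹ m j|) fun k _ => ?_).trans ?_)
      · rw [abs_mul]
        exact mul_le_mul (h.2 (scaledEvent x₁ L y) (scaledEvent_mem_ball hL hy) m k).1 (hm' k) (abs_nonneg _) hε
      · simp
    have h6 : |(1 : Matrix (Fin 4) (Fin 4) ℝ) m j| ≤ 1 := by
      rw [Matrix.one_apply]; split_ifs <;> simp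
    have h7 : |g⁻¹ m j| ≤ 1 + 4 * (ε * |g⁻¹ m j|) := by
      conv_lhs => rw [← h4, h3]
      exact (abs_sub _ _).trans (add_le_add h6 h5)
    have h8 : ε * |g⁻¹ m j| ≤ 1 / 100 * |g⁻¹ m j| :=
      mul_le_mul_of_nonneg_right hε1 (abs_nonneg _)
    linarith
  refine ⟨fun y hy => hbd y hy i j, fun y hy z hz => ?_⟩
  set g := S.metric (scaledEvent x₁ L y) with hg
  set g' := S.metric (scaledEvent x₁ L z) with hg'
  have h1 : g⁻¹ - g'⁻¹ = g⁻¹ * ((g' - g) * g'⁻¹) := by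
    rw [sub_mul, mul_sub, S.metric_mul_inv (scaledEvent_mem hL h.1 hz), mul_one, ← mul_assoc,
      S.inv_mul_metric (scaledEvent_mem hL h.1 hy), one_mul]
  have h2 : ∀ k l, |(g' - g) k l| ≤ 3 * ε * dist y z := fun k l => by
    have := (h.metric hL hε k l).2 z hz y hy
    rwa [sub_sub_sub_cancel_right, dist_comm] at this
  have h3 : ∀ k, |((g' - g) * g'⁻¹) k j| ≤ 4 * (3 * ε * dist y z * 2) := fun k => by
    rw [Matrix.mul_apply]
    refine (Finset.abs_sum_le_sum_abs _ _).trans ((Finset.sum_le_card_nsmul _ _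
        (3 * ε * dist y z * 2) fun l _ => ?_).trans (by simp))
    rw [abs_mul]
    exact mul_le_mul (h2 k l) (hbd z hz l j) (abs_nonneg _) (by positivity)
  have h4 : |(g⁻¹ - g'⁻¹) i j| ≤ 4 * (2 * (4 * (3 * ε * dist y z * 2))) := by
    rw [h1, Matrix.mul_apply]
    refine (Finset.abs_sum_le_sum_abs _ _).trans ((Finset.sum_le_card_nsmul _ _
        (2 * (4 * (3 * ε * dist y z * 2))) fun k _ => ?_).trans (by simp))
    rw [abs_mul]
    exact mul_le_mul (hbd y hy i k) (h3 k) (abs_nonneg _) zero_le_two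
  refine h4.trans ?_
  have hd := dist_nonneg (x := y) (y := z)
  linarith [mul_le_mul_of_nonneg_right hε1 hd]

lemma IsGentle.christoffel (h : S.IsGentle ε x₁ L) (hL : 0 < L) (hε : 0 ≤ ε) (hε1 : ε ≤ 1 / 100)
    (k i j : Fin 4) : BddLip (72 * ε) (Metric.ball (0 : Pos) 2)
      fun y => L * S.christoffel k i j (scaledEvent x₁ L y) := by
  have h1 := (BddLip.sum fun l => (h.inv_metric hL hε hε1 k l).mul
    (((h.pd_metric hL hε i j l).add (h.pd_metric hL hε j i l)).sub
      (h.pd_metric hL hε l i j))).const_mul (1 / 2)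
  refine (h1.mono ?_).congr fun y _ => ?_
  · rw [abs_of_pos (by norm_num)]
    simp only [Fintype.card_fin, Nat.cast_ofNat]
    linarith
  · simp only [StaticSpacetime.christoffel, Finset.mul_sum]
    refine Finset.sum_congr rfl fun l _ => ?_
    ring

lemma IsGentle.lapse_sub_one (h : S.IsGentle ε x₁ L) (hL : 0 < L) (hε : 0 ≤ ε) :
    BddLip (3 * ε) (Metric.ball (0 : Pos) 2) fun y => S.lapse x₁ L y - 1 :=
  (h.metric hL hε 0 0).neg.congr fun y _ => by simp [lapse, minkowski]; ring

lemma IsGentle.lapse_inv (h : S.IsGentle ε x₁ L) (hL : 0 < L) (hε : 0 ≤ ε) (hε1 : ε ≤ 1 / 100) :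
    BddLip (12 * ε) (Metric.ball (0 : Pos) 2) fun y => (S.lapse x₁ L y)⁻¹ - 1 :=
  ((h.lapse_sub_one hL hε).inv (by linarith)).mono (by linarith)

lemma IsGentle.spatial_sub (h : S.IsGentle ε x₁ L) (hL : 0 < L) (hε : 0 ≤ ε) (i j : Fin 3) :
    BddLip (3 * ε) (Metric.ball (0 : Pos) 2)
      fun y => S.spatial x₁ L i j y - if i = j then 1 else 0 :=
  (h.metric hL hε i.succ j.succ).congr fun y _ => by simp [spatial, minkowski]

lemma BddLip.of_sub {X : Type*} [PseudoMetricSpace X] {s : Set X} {f : X → ℝ} {κ c : ℝ}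
    (hf : BddLip κ s fun x => f x - c) (hκ : κ ≤ 1) (hc : |c| ≤ 1) : BddLip 2 s f :=
  ((hf.add (BddLip.const hc)).mono (by linarith)).congr fun x _ => by simp

lemma IsGentle.scaledCoeff (h : S.IsGentle ε x₁ L) (hL : 0 < L) (hε : 0 ≤ ε) (hε1 : ε ≤ 1 / 100)
    (k i j : Fin 3) : BddLip (2000 * ε) (Metric.ball (0 : Pos) 2) (S.scaledCoeff x₁ L k i j) := by
  have h1 := BddLip.of_sub (h.spatial_sub hL hε i j) (by linarith)
    (by split_ifs <;> simp)
  have h2 := BddLip.of_sub (h.lapse_inv hL hε hε1) (by linarith) (by simp)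
  refine ((((h.christoffel hL hε hε1 k.succ 0 0).mul (h1.mul h2)).add
    (h.christoffel hL hε hε1 k.succ i.succ j.succ)).mono (by linarith)).congr fun y _ => ?_
  simp only [StaticSpacetime.scaledCoeff, opticalCoeff, lapse, spatial]
  ring

end StaticSpacetime

/-- Two functions bounded and Lipschitz with constant `M` whose difference is so with `κ`. -/
structure Near {X : Type*} [PseudoMetricSpace X] (κ M : ℝ) (s : Set X) (f g : X → ℝ) : Prop where
  diff : BddLip κ s fun x => f x - g x
  left : BddLip M s f
  right : BddLip M s g

namespace Near

variable {X ι : Type*} [PseudoMetricSpace X] {κ κ' M M' : ℝ} {s : Set X} {f g f' g' : X → ℝ}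

lemma of_right (h : BddLip κ s fun x => f x - g x) (hg : BddLip M s g) :
    Near κ (κ + M) s f g :=
  ⟨h, (h.add hg).congr fun x _ => by simp, by
    refine ⟨fun x hx => ?_, fun x hx y hy => ?_⟩
    · linarith [hg.1 x hx, (abs_nonneg _).trans (h.1 x hx)]
    · have := hg.2 x hx y hy
      have h2 := (abs_nonneg _).trans (h.1 x hx)
      nlinarith [mul_nonneg h2 (dist_nonneg (x := x) (y := y))]⟩

lemma mono {κ₁ M₁ : ℝ} (h : Near κ M s f g) (hκ : κ ≤ κ₁) (hM : M ≤ M₁) : Near κ₁ M₁ s f g :=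
  ⟨h.diff.mono hκ, h.left.mono hM, h.right.mono hM⟩

lemma mul (h : Near κ M s f g) (h' : Near κ' M' s f' g') :
    Near (2 * κ * M' + 2 * M * κ') (2 * M * M') s (fun x => f x * f' x) fun x => g x * g' x :=
  ⟨((h.diff.mul h'.left).add (h.right.mul h'.diff)).congr fun x _ => by ring,
    h.left.mul h'.left, h.right.mul h'.right⟩

lemma sum [Fintype ι] {f g : ι → X → ℝ} (h : ∀ i, Near κ M s (f i) (g i)) :
    Near (Fintype.card ι * κ) (Fintype.card ι * M) s (fun x => ∑ i, f i x) fun x => ∑ i, g i x :=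
  ⟨(BddLip.sum fun i => (h i).diff).congr fun x _ => by simp, BddLip.sum fun i => (h i).left,
    BddLip.sum fun i => (h i).right⟩

end Near

lemma BddLip.continuousOn {X : Type*} [PseudoMetricSpace X] {s : Set X} {f : X → ℝ} {κ : ℝ}
    (hf : BddLip κ s f) (hκ : 0 ≤ κ) : ContinuousOn f s :=
  (LipschitzOnWith.of_dist_le_mul (K := ⟨κ, hκ⟩) fun x hx y hy => by
    rw [Real.dist_eq]; exact hf.2 x hx y hy).continuousOn

namespace StaticSpacetime

/-- A family of spatial light paths `Y a b`, with velocities `W a b`, in scaled coordinates: there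
is one from each `a` to each `b`, it is close to the segment, and there are no others. -/
structure LightPaths (S : StaticSpacetime) (x₁ : Pos) (L K : ℝ) (Y W : Pos → Pos → ℝ → Pos) :
    Prop where
  sol : ∀ a ∈ Metric.ball (0 : Pos) (5 / 4), ∀ b ∈ Metric.ball (0 : Pos) (5 / 4),
    IsSol (quadAcc (S.scaledCoeff x₁ L)) (Y a b) (W a b)
  start : ∀ a b, Y a b 0 = a
  finish : ∀ a b, Y a b 1 = b
  mem : ∀ a ∈ Metric.ball (0 : Pos) (5 / 4), ∀ b ∈ Metric.ball (0 : Pos) (5 / 4),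
    ∀ s ∈ Icc (0 : ℝ) 1, Y a b s ∈ Metric.ball (0 : Pos) 2
  vel : ∀ a b, ∀ s ∈ Icc (0 : ℝ) 1, ‖W a b s - (b - a)‖ ≤ K
  lip : ∀ a b a' b', ∀ s ∈ Icc (0 : ℝ) 1, ‖Y a b s - Y a' b' s‖ ≤ 6 * (‖a - a'‖ + ‖b - b'‖)
  lip_vel : ∀ a b a' b', ∀ s ∈ Icc (0 : ℝ) 1,
    ‖(W a b s - (b - a)) - (W a' b' s - (b' - a'))‖ ≤ K * (6 * (‖a - a'‖ + ‖b - b'‖))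
  unique : ∀ a ∈ Metric.ball (0 : Pos) (5 / 4), ∀ b ∈ Metric.ball (0 : Pos) (5 / 4), ∀ y w,
    IsSol (quadAcc (S.scaledCoeff x₁ L)) y w → (∀ s ∈ Icc (0 : ℝ) 1, y s ∈ Metric.ball (0 : Pos) 2) →
    y 0 = a → y 1 = b → ∀ s ∈ Icc (0 : ℝ) 1, y s = Y a b s ∧ w s = W a b s

variable {S : StaticSpacetime} {x₁ : Pos} {L ε K : ℝ} {Y W : Pos → Pos → ℝ → Pos}

theorem IsGentle.exists_lightPaths (h : S.IsGentle ε x₁ L) (hL : 0 < L) (hε : 0 ≤ ε)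
    (hε1 : ε ≤ 1 / 10 ^ 10) : ∃ Y W, S.LightPaths x₁ L (86400000 * ε) Y W := by
  have hQ := h.scaledCoeff hL hε (hε1.trans (by norm_num))
  obtain ⟨F, hF, hFQ⟩ := exists_smallField (by positivity) hQ
  rw [show 43200 * (2000 * ε) = 86400000 * ε by ring] at hF
  have hK : 86400000 * ε ≤ 1 / 100 := by linarith
  choose Y W hsol h0 h1 using exists_isSol hF (hK.trans (by norm_num))
  have hvel : ∀ a b, ∀ s ∈ Icc (0 : ℝ) 1, ‖W a b s - (b - a)‖ ≤ 86400000 * ε := fun a b s hs => by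
    simpa only [h0, h1] using (hsol a b).norm_vel_sub_le hF hs
  have hmem : ∀ a ∈ Metric.ball (0 : Pos) (5 / 4), ∀ b ∈ Metric.ball (0 : Pos) (5 / 4),
    ∀ s ∈ Icc (0 : ℝ) 1, Y a b s ∈ Metric.ball (0 : Pos) 2 := fun a ha b hb s hs => by
    have e1 := (hsol a b).norm_pos_sub_le hF hs
    rw [h0, h1] at e1
    have e2 : a + s • (b - a) ∈ Metric.ball (0 : Pos) (5 / 4) :=
      (convex_ball _ _).add_smul_sub_mem ha hb hs
    rw [mem_ball_zero_iff] at e2 ⊢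
    have := norm_add_le (Y a b s - (a + s • (b - a))) (a + s • (b - a))
    rw [sub_add_cancel] at this
    linarith
  refine ⟨Y, W, fun a ha b hb => ⟨(hsol a b).vel, fun s hs => ?_⟩, h0, h1, hmem, hvel,
    fun a b a' b' s hs => ?_, fun a b a' b' s hs => ?_, fun a ha b hb y w hyw hy hya hyb s hs => ?_⟩
  · refine ((hsol a b).acc s hs).congr_deriv (hFQ _ (hmem a ha b hb s hs) _ ?_)
    have := norm_add_le (W a b s - (b - a)) (b - a)
    rw [sub_add_cancel] at this
    rw [mem_ball_zero_iff] at ha hb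
    linarith [hvel a b s hs, norm_sub_le b a]
  · have := ((hsol a b).stability (hsol a' b') hF (hK.trans (by norm_num)) hs).1
    simp only [h0, h1] at this
    linarith [norm_nonneg (W a b s - W a' b' s)]
  · have := ((hsol a b).stability (hsol a' b') hF (hK.trans (by norm_num)) hs).2
    simpa only [h0, h1] using this
  · have hsolF : IsSol F y w := ⟨hyw.vel, fun s hs => (hyw.acc s hs).congr_deriv
      (hFQ _ (hy s hs) _ (norm_velocity_le (κ := 2000 * ε) (by linarith)
        (fun y hy k i j => (hQ k i j).1 y hy) hyw hy hs)).symm⟩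
    exact hsolF.eqOn (hsol a b) hF (hK.trans (by norm_num)) (by rw [hya, h0]) (by rw [hyb, h1]) hs

variable (S x₁ L) in
/-- The time that light needs from `a` to `b` along the path `Y a b`, in units of `L`. -/
def travelTime (Y W : Pos → Pos → ℝ → Pos) (a b : Pos) : ℝ :=
  √(S.lapse x₁ L a * S.spatialSq x₁ L a (W a b 0)) * ∫ s in (0 : ℝ)..1, (S.lapse x₁ L (Y a b s))⁻¹

lemma IsGentle.continuousOn_lapse_inv (h : S.IsGentle ε x₁ L) (hL : 0 < L) (hε : 0 ≤ ε)
    (hε1 : ε ≤ 1 / 100) {y : ℝ → Pos} {I : Set ℝ} (hy : ContinuousOn y I)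
    (hm : MapsTo y I (Metric.ball (0 : Pos) 2)) :
    ContinuousOn (fun s => (S.lapse x₁ L (y s))⁻¹) I :=
  ((((h.lapse_inv hL hε hε1).continuousOn (by positivity)).comp hy hm).add
    (continuousOn_const (c := (1 : ℝ)))).congr fun s _ => by simp

/-- The squared travel time differs little from the squared Euclidean distance. -/
theorem LightPaths.bddLip_travelTime (hP : S.LightPaths x₁ L (86400000 * ε) Y W)
    (h : S.IsGentle ε x₁ L) (hL : 0 < L) (hε : 0 ≤ ε) (hε1 : ε ≤ 1 / 10 ^ 10) :
    BddLip (10 ^ 14 * ε) (Metric.ball (0 : Pos) (5 / 4) ×ˢ Metric.ball (0 : Pos) (5 / 4))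
      fun p => S.travelTime x₁ L Y W p.1 p.2 ^ 2 - ‖p.2 - p.1‖ ^ 2 := by
  set Ω := Metric.ball (0 : Pos) (5 / 4) ×ˢ Metric.ball (0 : Pos) (5 / 4) with hΩ
  have hε2 : ε ≤ 1 / 100 := hε1.trans (by norm_num)
  have hsub : ∀ a ∈ Metric.ball (0 : Pos) (5 / 4), a ∈ Metric.ball (0 : Pos) 2 := fun a ha =>
    Metric.ball_subset_ball (by norm_num) ha
  have hdist : ∀ p q : Pos × Pos, ‖p.1 - q.1‖ ≤ dist p q ∧ ‖p.2 - q.2‖ ≤ dist p q := fun p q => by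
    rw [← dist_eq_norm, ← dist_eq_norm]; exact ⟨le_max_left _ _, le_max_right _ _⟩
  have hone : BddLip 1 Ω fun _ => (1 : ℝ) := BddLip.const (by simp)
  have hfst : ∀ {κ : ℝ} {f : Pos → ℝ}, BddLip κ (Metric.ball (0 : Pos) 2) f →
      BddLip κ Ω fun p => f p.1 := fun hf => by
    simpa only [one_mul] using hf.comp (C := 1) (φ := Prod.fst) (t := Ω) le_rfl
      (fun p hp => hsub _ hp.1) (fun p _ q _ => by rw [one_mul]; exact le_max_left _ _)
  have hN : Near (3 * ε) 2 Ω (fun p => S.lapse x₁ L p.1) fun _ => 1 :=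
    (Near.of_right (hfst (h.lapse_sub_one hL hε)) hone).mono le_rfl (by linarith)
  have hJ : Near (144 * ε) 2 Ω (fun p => ∫ s in (0 : ℝ)..1, (S.lapse x₁ L (Y p.1 p.2 s))⁻¹)
      fun _ => 1 := by
    have hint : ∀ p ∈ Ω, IntervalIntegrable (fun s => (S.lapse x₁ L (Y p.1 p.2 s))⁻¹)
        MeasureTheory.volume 0 1 := fun p hp => by
      refine ContinuousOn.intervalIntegrable ?_
      rw [uIcc_of_le zero_le_one]
      exact h.continuousOn_lapse_inv hL hε hε2
        (fun s hs => ((hP.sol _ hp.1 _ hp.2).vel s hs).continuousWithinAt) (hP.mem _ hp.1 _ hp.2)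
    have hio : ∀ s ∈ uIoc (0 : ℝ) 1, s ∈ Icc (0 : ℝ) 1 := fun s hs => by
      rw [uIoc_of_le zero_le_one] at hs; exact ⟨hs.1.le, hs.2⟩
    refine (Near.of_right ⟨fun p hp => ?_, fun p hp q hq => ?_⟩ hone).mono le_rfl (by linarith)
    · have e : (∫ s in (0 : ℝ)..1, (S.lapse x₁ L (Y p.1 p.2 s))⁻¹) - 1 =
          ∫ s in (0 : ℝ)..1, ((S.lapse x₁ L (Y p.1 p.2 s))⁻¹ - 1) := by
        rw [intervalIntegral.integral_sub (hint p hp) (by simp)]; simp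
      beta_reduce
      rw [e, ← Real.norm_eq_abs]
      refine (intervalIntegral.norm_integral_le_of_norm_le_const fun s hs =>
        (h.lapse_inv hL hε hε2).1 _ (hP.mem _ hp.1 _ hp.2 s (hio s hs))).trans ?_
      norm_num
      linarith
    · rw [sub_sub_sub_cancel_right, ← intervalIntegral.integral_sub (hint p hp) (hint q hq),
        ← Real.norm_eq_abs]
      refine (intervalIntegral.norm_integral_le_of_norm_le_const (C := 144 * ε * dist p q)
        fun s hs => ?_).trans (by simp)
      have e1 := (h.lapse_inv hL hε hε2).2 _ (hP.mem _ hp.1 _ hp.2 s (hio s hs)) _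
        (hP.mem _ hq.1 _ hq.2 s (hio s hs))
      rw [sub_sub_sub_cancel_right] at e1
      refine e1.trans ?_
      have e2 := hP.lip p.1 p.2 q.1 q.2 s (hio s hs)
      rw [← dist_eq_norm] at e2
      have e3 : dist (Y p.1 p.2 s) (Y q.1 q.2 s) ≤ 12 * dist p q := by
        linarith [(hdist p q).1, (hdist p q).2]
      linarith [mul_le_mul_of_nonneg_left e3 (by positivity : 0 ≤ 12 * ε)]
  have h0 : (0 : ℝ) ∈ Icc (0 : ℝ) 1 := left_mem_Icc.2 zero_le_one
  have hU : ∀ i, BddLip 3 Ω fun p : Pos × Pos => (p.2 - p.1) i := fun i => by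
    refine ⟨fun p hp => ?_, fun p hp q hq => ?_⟩
    · have e1 := hp.1
      have e2 := hp.2
      rw [mem_ball_zero_iff] at e1 e2
      linarith [abs_apply_le_norm (p.2 - p.1) i, norm_sub_le p.2 p.1]
    · have e := abs_apply_le_norm ((p.2 - q.2) - (p.1 - q.1)) i
      rw [show (p.2 - p.1) i - (q.2 - q.1) i = ((p.2 - q.2) - (p.1 - q.1)) i by
        simp only [PiLp.sub_apply]; ring]
      linarith [norm_sub_le (p.2 - q.2) (p.1 - q.1), (hdist p q).1, (hdist p q).2,
        dist_nonneg (x := p) (y := q)]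
  have hW : ∀ i, Near (12 * (86400000 * ε)) 4 Ω (fun p => W p.1 p.2 0 i)
      fun p => (p.2 - p.1) i := fun i => by
    refine (Near.of_right ⟨fun p hp => ?_, fun p hp q hq => ?_⟩ (hU i)).mono le_rfl (by linarith)
    · have e1 := abs_apply_le_norm (W p.1 p.2 0 - (p.2 - p.1)) i
      have e2 := hP.vel p.1 p.2 0 h0
      rw [PiLp.sub_apply] at e1
      linarith
    · have e1 := abs_apply_le_norm ((W p.1 p.2 0 - (p.2 - p.1)) - (W q.1 q.2 0 - (q.2 - q.1))) i
      have e2 := hP.lip_vel p.1 p.2 q.1 q.2 0 h0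
      simp only [PiLp.sub_apply] at e1 ⊢
      refine e1.trans (e2.trans ?_)
      have e3 := add_le_add (hdist p q).1 (hdist p q).2
      linarith [mul_le_mul_of_nonneg_left e3 (by positivity : 0 ≤ 86400000 * ε)]
  have hh : ∀ i j : Fin 3, Near (3 * ε) 2 Ω (fun p => S.spatial x₁ L i j p.1)
      fun _ => if i = j then 1 else 0 := fun i j =>
    (Near.of_right (hfst (h.spatial_sub hL hε i j))
      (BddLip.const (K := 1) (by split_ifs <;> simp))).mono le_rfl (by linarith)
  have hS := Near.sum fun i => Near.sum fun j => ((hh i j).mul (hW i)).mul (hW j)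
  refine ((((hN.mul hJ).mul hJ).mul hS).diff.mono ?_).congr fun p hp => ?_
  · simp only [Fintype.card_fin, Nat.cast_ofNat]
    linarith
  · have e1 : 0 ≤ S.lapse x₁ L p.1 * S.spatialSq x₁ L p.1 (W p.1 p.2 0) := by
      rw [← lapse_mul_slowness_sq hL h.1 (hsub _ hp.1)]
      have := lapse_pos hL h.1 (hsub _ hp.1)
      positivity
    have e2 : ‖p.2 - p.1‖ ^ 2 =
        ∑ i, ∑ j, (if i = j then (1 : ℝ) else 0) * (p.2 - p.1) i * (p.2 - p.1) j := by
      rw [norm_sq_pos]; simp [Fin.sum_univ_three]; ring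
    rw [e2, travelTime, mul_pow, Real.sq_sqrt e1, spatialSq]
    ring

end StaticSpacetime

namespace StaticSpacetime

variable {S : StaticSpacetime} {x₁ : Pos} {L ε : ℝ} {Y W : Pos → Pos → ℝ → Pos}

lemma IsGentle.continuousOn_slowness (h : S.IsGentle ε x₁ L) (hL : 0 < L) (hε : 0 ≤ ε)
    (hε1 : ε ≤ 1 / 100) {y w : ℝ → Pos} {I : Set ℝ} (hy : ContinuousOn y I)
    (hw : ContinuousOn w I) (hm : MapsTo y I (Metric.ball (0 : Pos) 2)) :
    ContinuousOn (fun s => S.slowness x₁ L (y s) (w s)) I := by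
  have h1 : ∀ i j : Fin 3, ContinuousOn (fun s => S.spatial x₁ L i j (y s)) I := fun i j =>
    ((((h.spatial_sub hL hε i j).continuousOn (by positivity)).comp hy hm).add
      (continuousOn_const (c := (if i = j then 1 else 0 : ℝ)))).congr fun s _ => by simp
  have h2 : ∀ i : Fin 3, ContinuousOn (fun s => w s i) I := fun i =>
    (EuclideanSpace.proj (𝕜 := ℝ) i).continuous.comp_continuousOn hw
  refine ContinuousOn.sqrt (ContinuousOn.mul ?_ (h.continuousOn_lapse_inv hL hε hε1 hy hm))
  exact continuousOn_finsetSum _ fun i _ => continuousOn_finsetSum _ fun j _ =>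
    ((h1 i j).mul (h2 i)).mul (h2 j)

/-- The coordinate time elapsed along a spatial light path. -/
lemma IsGentle.elapsed_time (h : S.IsGentle ε x₁ L) (hL : 0 < L) (hε : 0 ≤ ε)
    (hε1 : ε ≤ 1 / 100) {y w : ℝ → Pos} (hsol : IsSol (quadAcc (S.scaledCoeff x₁ L)) y w)
    (hy : ∀ s ∈ Icc (0 : ℝ) 1, y s ∈ Metric.ball (0 : Pos) 2)
    (hw : ∀ s ∈ Icc (0 : ℝ) 1, w s ≠ 0) {t : ℝ → ℝ}
    (ht : ∀ s ∈ Icc (0 : ℝ) 1, HasDerivWithinAt t (L * S.slowness x₁ L (y s) (w s)) (Icc 0 1) s) :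
    t 1 = t 0 + L * (√(S.lapse x₁ L (y 0) * S.spatialSq x₁ L (y 0) (w 0)) *
      ∫ s in (0 : ℝ)..1, (S.lapse x₁ L (y s))⁻¹) := by
  have h0 : (0 : ℝ) ∈ Icc (0 : ℝ) 1 := left_mem_Icc.2 zero_le_one
  have hN0 := lapse_pos hL h.1 (hy 0 h0)
  set E := S.lapse x₁ L (y 0) * S.slowness x₁ L (y 0) (w 0) with hE
  have hE0 : √(S.lapse x₁ L (y 0) * S.spatialSq x₁ L (y 0) (w 0)) = E := by
    rw [← lapse_mul_slowness_sq hL h.1 (hy 0 h0), hE, ← Real.sqrt_sq (mul_nonneg hN0.le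
      (Real.sqrt_nonneg _) : 0 ≤ S.lapse x₁ L (y 0) * S.slowness x₁ L (y 0) (w 0))]
    congr 1; ring
  have hslow : ∀ s ∈ Icc (0 : ℝ) 1,
      L * S.slowness x₁ L (y s) (w s) = (L * E) * (S.lapse x₁ L (y s))⁻¹ := fun s hs => by
    have h1 := lapse_mul_slowness_const hL h.1 hsol hy hw ht hs
    have h2 := (lapse_pos hL h.1 (hy s hs)).ne'
    rw [← hE] at h1
    rw [← h1]
    field_simp
  have hc := h.continuousOn_lapse_inv hL hε hε1
    (fun s hs => (hsol.vel s hs).continuousWithinAt) hy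
  have hi : IntervalIntegrable (fun s => (L * E) * (S.lapse x₁ L (y s))⁻¹)
      MeasureTheory.volume 0 1 := by
    refine ContinuousOn.intervalIntegrable ?_
    rw [uIcc_of_le zero_le_one]
    exact continuousOn_const.mul hc
  have hftc := intervalIntegral.integral_eq_sub_of_hasDerivAt_of_le zero_le_one
    (fun s hs => (ht s hs).continuousWithinAt)
    (fun s hs => (hslow s (Ioo_subset_Icc_self hs)) ▸
      (ht s (Ioo_subset_Icc_self hs)).hasDerivAt (Icc_mem_nhds hs.1 hs.2)) hi
  rw [intervalIntegral.integral_const_mul] at hftc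
  rw [hE0]
  linarith

lemma IsGentle.exists_time (h : S.IsGentle ε x₁ L) (hL : 0 < L) (hε : 0 ≤ ε)
    (hε1 : ε ≤ 1 / 100) {y w : ℝ → Pos} (hsol : IsSol (quadAcc (S.scaledCoeff x₁ L)) y w)
    (hy : ∀ s ∈ Icc (0 : ℝ) 1, y s ∈ Metric.ball (0 : Pos) 2) (t₀ : ℝ) :
    ∃ t : ℝ → ℝ, t 0 = t₀ ∧ ∀ s ∈ Icc (0 : ℝ) 1,
      HasDerivWithinAt t (L * S.slowness x₁ L (y s) (w s)) (Icc 0 1) s := by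
  have hc := h.continuousOn_slowness hL hε hε1
    (fun s hs => (hsol.vel s hs).continuousWithinAt)
    (fun s hs => (hsol.acc s hs).continuousWithinAt) hy
  have hc' : Continuous (IccExtend (zero_le_one (α := ℝ))
      ((Icc 0 1).domRestrict fun s => L * S.slowness x₁ L (y s) (w s))) :=
    (continuousOn_iff_continuous_domRestrict.1 (continuousOn_const.mul hc)).Icc_extend'
  refine ⟨fun s => t₀ + ∫ r in (0 : ℝ)..s, IccExtend (zero_le_one (α := ℝ))
      ((Icc 0 1).domRestrict fun s => L * S.slowness x₁ L (y s) (w s)) r, by simp, fun s hs => ?_⟩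
  refine ((hasDerivAt_integral_of_continuous' hc' s).const_add t₀).hasDerivWithinAt.congr_deriv ?_
  rw [IccExtend_of_mem _ _ hs]
  rfl

/-- Separated positions in the part of the ball where light paths are considered. -/
structure Separated (a b : Pos) : Prop where
  left : a ∈ Metric.ball (0 : Pos) (5 / 4)
  right : b ∈ Metric.ball (0 : Pos) (5 / 4)
  dist : 1 / 2 ≤ ‖b - a‖

lemma Separated.symm {a b : Pos} (h : Separated a b) : Separated b a :=
  ⟨h.right, h.left, by rw [norm_sub_rev]; exact h.dist⟩

namespace LightPaths

lemma vel_ne_zero (hP : S.LightPaths x₁ L (86400000 * ε) Y W) (hε1 : ε ≤ 1 / 10 ^ 10) {a b : Pos}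
    (hab : Separated a b) : ∀ s ∈ Icc (0 : ℝ) 1, W a b s ≠ 0 := fun s hs h0 => by
  have h1 := hP.vel a b s hs
  rw [h0, zero_sub, norm_neg] at h1
  linarith [hab.dist]

/-- Future-pointing null geodesics between resting positions follow the light path. -/
lemma future (hP : S.LightPaths x₁ L (86400000 * ε) Y W) (h : S.IsGentle ε x₁ L) (hL : 0 < L)
    {a b : Pos} (hab : Separated a b) {γ : ℝ → Event}
    (hγ : S.IsFutureNullGeodesic (cylinder (Metric.ball x₁ (2 * L))) γ)
    (h0 : spacePart (γ 0) = x₁ + L • a) (h1 : spacePart (γ 1) = x₁ + L • b) :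
    ∀ s ∈ Icc (0 : ℝ) 1, spacePart (γ s) = x₁ + L • Y a b s ∧
      HasDerivWithinAt (fun s => γ s 0) (L * S.slowness x₁ L (Y a b s) (W a b s)) (Icc 0 1) s := by
  obtain ⟨v, hv, hf⟩ := hγ
  obtain ⟨y, w, hy, hm, hsol, ht⟩ := hv.reduce hL h.1 hf
  have hinj : ∀ {p q : Pos}, x₁ + L • p = x₁ + L • q → p = q := fun {p q} e =>
    smul_right_injective _ hL.ne' (add_left_cancel e)
  have hu := hP.unique a hab.left b hab.right y w hsol hm (hinj ((hy 0).symm.trans h0))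
    (hinj ((hy 1).symm.trans h1))
  intro s hs
  obtain ⟨e1, e2⟩ := hu s hs
  rw [← e1, ← e2]
  exact ⟨hy s, ht s hs⟩

lemma time_of_future (hP : S.LightPaths x₁ L (86400000 * ε) Y W) (h : S.IsGentle ε x₁ L)
    (hL : 0 < L) (hε : 0 ≤ ε) (hε1 : ε ≤ 1 / 10 ^ 10) {a b : Pos} (hab : Separated a b)
    {γ : ℝ → Event} (hγ : S.IsFutureNullGeodesic (cylinder (Metric.ball x₁ (2 * L))) γ)
    (h0 : spacePart (γ 0) = x₁ + L • a) (h1 : spacePart (γ 1) = x₁ + L • b) :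
    γ 1 0 = γ 0 0 + L * S.travelTime x₁ L Y W a b := by
  have e := h.elapsed_time hL hε (hε1.trans (by norm_num)) (hP.sol a hab.left b hab.right)
    (hP.mem a hab.left b hab.right) (hP.vel_ne_zero hε1 hab) (t := fun s => γ s 0)
    fun s hs => (hP.future h hL hab hγ h0 h1 s hs).2
  rw [hP.start] at e
  exact e

lemma eqOn_of_future (hP : S.LightPaths x₁ L (86400000 * ε) Y W) (h : S.IsGentle ε x₁ L)
    (hL : 0 < L) {a b : Pos} (hab : Separated a b)
    {γ δ : ℝ → Event} (hγ : S.IsFutureNullGeodesic (cylinder (Metric.ball x₁ (2 * L))) γ)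
    (h0 : spacePart (γ 0) = x₁ + L • a) (h1 : spacePart (γ 1) = x₁ + L • b)
    (hδ : S.IsFutureNullGeodesic (cylinder (Metric.ball x₁ (2 * L))) δ)
    (h0' : spacePart (δ 0) = x₁ + L • a) (h1' : spacePart (δ 1) = x₁ + L • b)
    {r : ℝ} (hr : r ∈ Icc (0 : ℝ) 1) (ht : γ r 0 = δ r 0) : EqOn γ δ (Icc 0 1) := by
  have e := hP.future h hL hab hγ h0 h1
  have e' := hP.future h hL hab hδ h0' h1'
  have hc : ∀ s ∈ Icc (0 : ℝ) 1, γ s 0 - δ s 0 = γ 0 0 - δ 0 0 := fun s hs =>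
    eq_of_hasDerivWithinAt_zero (f := fun s => γ s 0 - δ s 0)
      (fun s hs => ((e s hs).2.sub (e' s hs).2).congr_deriv (sub_self _)) hs
  intro s hs
  rw [← event_spacePart (γ s), ← event_spacePart (δ s), (e s hs).1, (e' s hs).1]
  congr 1
  linarith [hc s hs, hc r hr]

lemma exists_future (hP : S.LightPaths x₁ L (86400000 * ε) Y W) (h : S.IsGentle ε x₁ L)
    (hL : 0 < L) (hε : 0 ≤ ε) (hε1 : ε ≤ 1 / 10 ^ 10) {a b : Pos} (hab : Separated a b) (t₀ : ℝ) :
    ∃ γ, S.IsFutureNullGeodesic (cylinder (Metric.ball x₁ (2 * L))) γ ∧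
      γ 0 = event t₀ (x₁ + L • a) ∧
      γ 1 = event (t₀ + L * S.travelTime x₁ L Y W a b) (x₁ + L • b) := by
  obtain ⟨t, ht0, ht⟩ := h.exists_time hL hε (hε1.trans (by norm_num))
    (hP.sol a hab.left b hab.right) (hP.mem a hab.left b hab.right) t₀
  have hγ := isFutureNullGeodesic_of_isSol hL h.1 (hP.sol a hab.left b hab.right)
    (hP.mem a hab.left b hab.right) (hP.vel_ne_zero hε1 hab) ht
  have h1 := hP.time_of_future h hL hε hε1 hab hγ (by simp [hP.start]) (by simp [hP.finish])
  simp only [event_zero, ht0] at h1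
  exact ⟨_, hγ, by simp only [ht0, hP.start], by simp only [h1, hP.finish]⟩

lemma travelTime_pos (hP : S.LightPaths x₁ L (86400000 * ε) Y W) (h : S.IsGentle ε x₁ L)
    (hL : 0 < L) (hε : 0 ≤ ε) (hε1 : ε ≤ 1 / 10 ^ 10) {a b : Pos} (hab : Separated a b) :
    0 < S.travelTime x₁ L Y W a b := by
  have h0 : (0 : ℝ) ∈ Icc (0 : ℝ) 1 := left_mem_Icc.2 zero_le_one
  have ha := hP.mem a hab.left b hab.right 0 h0
  rw [hP.start] at ha
  refine mul_pos (Real.sqrt_pos.2 (mul_pos (lapse_pos hL h.1 ha)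
    (spatialSq_pos hL h.1 ha (hP.vel_ne_zero hε1 hab 0 h0)))) ?_
  refine intervalIntegral.intervalIntegral_pos_of_pos_on (ContinuousOn.intervalIntegrable ?_)
    (fun s hs => inv_pos.2 (lapse_pos hL h.1
      (hP.mem a hab.left b hab.right s (Ioo_subset_Icc_self hs)))) zero_lt_one
  rw [uIcc_of_le zero_le_one]
  exact h.continuousOn_lapse_inv hL hε (hε1.trans (by norm_num))
    (fun s hs => ((hP.sol a hab.left b hab.right).vel s hs).continuousWithinAt)
    (hP.mem a hab.left b hab.right)

lemma travelTime_symm (hP : S.LightPaths x₁ L (86400000 * ε) Y W) (h : S.IsGentle ε x₁ L)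
    (hL : 0 < L) (hε : 0 ≤ ε) (hε1 : ε ≤ 1 / 10 ^ 10) {a b : Pos} (hab : Separated a b) :
    S.travelTime x₁ L Y W b a = S.travelTime x₁ L Y W a b := by
  have hm : MapsTo (fun s : ℝ => 1 - s) (Icc 0 1) (Icc 0 1) := fun s hs =>
    ⟨by linarith [hs.2], by linarith [hs.1]⟩
  have hd : ∀ s ∈ Icc (0 : ℝ) 1, HasDerivWithinAt (fun s : ℝ => 1 - s) (-1) (Icc 0 1) s :=
    fun s _ => by simpa using (hasDerivWithinAt_id s _).const_sub 1
  have hsol := hP.sol a hab.left b hab.right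
  obtain ⟨t, ht0, ht⟩ := h.exists_time hL hε (hε1.trans (by norm_num)) hsol
    (hP.mem a hab.left b hab.right) 0
  have h1 := h.elapsed_time hL hε (hε1.trans (by norm_num)) hsol
    (hP.mem a hab.left b hab.right) (hP.vel_ne_zero hε1 hab) ht
  have hγ := isFutureNullGeodesic_of_isSol hL h.1 (hsol.reverse fun s _ => quadAcc_neg _ _ _)
    (fun s hs => hP.mem a hab.left b hab.right _ (hm hs))
    (fun s hs => neg_ne_zero.2 (hP.vel_ne_zero hε1 hab _ (hm hs))) (t := fun s => -t (1 - s))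
    (fun s hs => by
      rw [slowness_neg]
      exact ((ht _ (hm hs)).scomp s (hd s hs) hm).neg.congr_deriv (by simp))
  have h2 := hP.time_of_future h hL hε hε1 hab.symm hγ (by simp [hP.finish]) (by simp [hP.start])
  simp only [event_zero, sub_self, sub_zero, ht0] at h2
  rw [hP.start, ht0] at h1
  refine mul_left_cancel₀ hL.ne' ?_
  simp only [travelTime] at h1 h2 ⊢
  linarith

end LightPaths

end StaticSpacetime

open StaticSpacetime

lemma hasDerivAt_rest (c : ℝ) (q : Pos) (ζ : ℝ) :
    HasDerivAt (fun ζ : ℝ => event (c * ζ) q) (event c 0) ζ := by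
  rw [← hasDerivWithinAt_univ]
  exact hasDerivWithinAt_event
    (((hasDerivAt_id ζ).const_mul c).congr_deriv (mul_one c)).hasDerivWithinAt
    (hasDerivWithinAt_const _ _ _)

lemma inner_rest {S : StaticSpacetime} {x : Event} (hx : x ∈ cylinder S.space) (c : ℝ) :
    S.inner x (event c 0) (event c 0) = S.metric x 0 0 * c ^ 2 := by
  rw [S.inner_self hx]
  simp

/-- The machine at rest at `q` whose clock advances by one in coordinate time `c`. -/
def restMachine (S : StaticSpacetime) (q : Pos) (hq : q ∈ S.space) (c : ℝ) (hc : 0 < c) :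
    OpenMachine S where
  worldline ζ := event (c * ζ) q
  mem _ := hq
  smooth := contDiff_pi.2 fun i => Fin.cases (contDiff_const.mul contDiff_id)
    (fun _ => contDiff_const) i
  embedding := by
    have hl : Function.LeftInverse (fun x : Event => c⁻¹ * x 0) fun ζ => event (c * ζ) q :=
      fun ζ => by simp [hc.ne']
    refine Topology.IsEmbedding.of_leftInverse hl (by fun_prop) ?_
    exact continuous_iff_continuousAt.2 fun ζ => (hasDerivAt_rest c q ζ).continuousAt
  timelike ζ := by
    rw [(hasDerivAt_rest c q ζ).deriv, inner_rest (show event (c * ζ) q ∈ cylinder S.space from hq)]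
    exact mul_neg_of_neg_of_pos (S.time_neg _ hq) (by positivity)
  future ζ := by
    rw [(hasDerivAt_rest c q ζ).deriv, FuturePointing,
      S.inner_time (show event (c * ζ) q ∈ cylinder S.space from hq)]
    exact mul_neg_of_neg_of_pos (S.time_neg _ hq) hc

lemma restMachine_hasProperPeriod {S : StaticSpacetime} {q : Pos} (hq : q ∈ S.space) {c : ℝ}
    (hc : 0 < c) : (restMachine S q hq c hc).HasProperPeriod (√(-S.metric (event 0 q) 0 0) * c) := by
  intro ζ
  have h : ∀ ζ : ℝ, √(-S.inner ((restMachine S q hq c hc).worldline ζ)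
      (deriv (restMachine S q hq c hc).worldline ζ)
      (deriv (restMachine S q hq c hc).worldline ζ)) = √(-S.metric (event 0 q) 0 0) * c := by
    intro ζ
    have hx : event (c * ζ) q ∈ cylinder S.space := hq
    change √(-S.inner (event (c * ζ) q) (deriv (fun ζ : ℝ => event (c * ζ) q) ζ)
      (deriv (fun ζ : ℝ => event (c * ζ) q) ζ)) = _
    rw [(hasDerivAt_rest c q ζ).deriv, inner_rest hx, S.metric_eq hx (y := event 0 q) rfl,
      ← neg_mul, Real.sqrt_mul (neg_pos.2 (S.time_neg _ hq)).le, Real.sqrt_sq hc.le]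
  simp [OpenMachine.properTime, h]

section Pairs

variable {S : StaticSpacetime} {x₁ : Pos} {L ε c : ℝ} {Y W : Pos → Pos → ℝ → Pos} {a b : Pos} {n : ℕ}

/-- Signals between resting machines arrive after `n` cycles, if the travel time is that long. -/
lemma signal_iff (hP : S.LightPaths x₁ L (86400000 * ε) Y W) (h : S.IsGentle ε x₁ L) (hL : 0 < L)
    (hε : 0 ≤ ε) (hε1 : ε ≤ 1 / 10 ^ 10) (hab : Separated a b) (hc : 0 < c)
    (hT : L * S.travelTime x₁ L Y W a b = c * n) (ha : x₁ + L • a ∈ S.space)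
    (hb : x₁ + L • b ∈ S.space) (α β : ℝ) :
    OpenMachine.Signal (cylinder (Metric.ball x₁ (2 * L))) (restMachine S (x₁ + L • a) ha c hc)
      (restMachine S (x₁ + L • b) hb c hc) α β ↔ β = α + n := by
  constructor
  · rintro ⟨γ, hγ, h0, h1⟩
    have e := hP.time_of_future h hL hε hε1 hab hγ (by rw [h0]; rfl) (by rw [h1]; rfl)
    rw [h0, h1, hT] at e
    have e' : c * β = c * α + c * n := e
    exact mul_left_cancel₀ hc.ne' (by rw [e']; ring)
  · rintro rfl
    obtain ⟨γ, hγ, h0, h1⟩ := hP.exists_future h hL hε hε1 hab (c * α)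
    refine ⟨γ, hγ, h0, ?_⟩
    rw [h1, hT, ← mul_add]
    rfl

lemma restMachine_isChannel (hP : S.LightPaths x₁ L (86400000 * ε) Y W) (h : S.IsGentle ε x₁ L)
    (hL : 0 < L) (hε : 0 ≤ ε) (hε1 : ε ≤ 1 / 10 ^ 10) (hab : Separated a b) (hc : 0 < c)
    (hT : L * S.travelTime x₁ L Y W a b = c * n) (ha : x₁ + L • a ∈ S.space)
    (hb : x₁ + L • b ∈ S.space) :
    OpenMachine.IsChannel (cylinder (Metric.ball x₁ (2 * L))) (restMachine S (x₁ + L • a) ha c hc)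
      (restMachine S (x₁ + L • b) hb c hc) (nullPhasePairs n) := by
  constructor
  · rintro _ ⟨k, rfl⟩
    rw [signal_iff hP h hL hε hε1 hab hc hT]
    simp [Reading.value, Reading.null]
  · rintro _ ⟨k, rfl⟩ _ ⟨l, rfl⟩ hkl
    simp only [Reading.value, Reading.null] at hkl ⊢
    push_cast
    linarith

lemma restMachine_hasEchoCount (hP : S.LightPaths x₁ L (86400000 * ε) Y W)
    (h : S.IsGentle ε x₁ L) (hL : 0 < L) (hε : 0 ≤ ε) (hε1 : ε ≤ 1 / 10 ^ 10)
    (hab : Separated a b) (hc : 0 < c) (hT : L * S.travelTime x₁ L Y W a b = c * n)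
    (ha : x₁ + L • a ∈ S.space) (hb : x₁ + L • b ∈ S.space) :
    OpenMachine.HasEchoCount (cylinder (Metric.ball x₁ (2 * L)))
      (restMachine S (x₁ + L • a) ha c hc) (restMachine S (x₁ + L • b) hb c hc) (2 * n) := by
  have hT' : L * S.travelTime x₁ L Y W b a = c * n := by
    rw [hP.travelTime_symm h hL hε hε1 hab, hT]
  intro k
  simp only [signal_iff hP h hL hε hε1 hab hc hT ha hb,
    signal_iff hP h hL hε hε1 hab.symm hc hT' hb ha, Nat.cast_mul, Nat.cast_ofNat]
  exact ⟨⟨_, rfl, by ring⟩, fun β α hβ hα => by rw [hα, hβ]; ring⟩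

lemma restMachine_radarLinkable (hP : S.LightPaths x₁ L (86400000 * ε) Y W)
    (h : S.IsGentle ε x₁ L) (hL : 0 < L) (hε : 0 ≤ ε) (hε1 : ε ≤ 1 / 10 ^ 10)
    (hab : Separated a b) (hc : 0 < c) (ha : x₁ + L • a ∈ S.space) (hb : x₁ + L • b ∈ S.space) :
    OpenMachine.RadarLinkable (cylinder (Metric.ball x₁ (2 * L)))
      (cylinder (Metric.ball x₁ (2 * L)))
      (restMachine S (x₁ + L • a) ha c hc) (restMachine S (x₁ + L • b) hb c hc) := by
  have hV : IsOpen (cylinder (Metric.ball x₁ (2 * L))) := isOpen_cylinder Metric.isOpen_ball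
  have hin : ∀ {q : Pos} (_ : q ∈ Metric.ball (0 : Pos) (5 / 4)) (hq : x₁ + L • q ∈ S.space),
      range (restMachine S (x₁ + L • q) hq c hc).worldline ⊆
        cylinder (Metric.ball x₁ (2 * L)) := by
    rintro q hq' hq _ ⟨ζ, rfl⟩
    exact (scaled_mem hL).2 (Metric.ball_subset_ball (by norm_num) hq')
  have hsp : ∀ {q : Pos} {hq : x₁ + L • q ∈ S.space} {x : Event},
      x ∈ range (restMachine S (x₁ + L • q) hq c hc).worldline → spacePart x = x₁ + L • q := by
    rintro q hq _ ⟨ζ, rfl⟩; rfl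
  have hran : ∀ {q : Pos} {hq : x₁ + L • q ∈ S.space} (t : ℝ),
      event t (x₁ + L • q) ∈ range (restMachine S (x₁ + L • q) hq c hc).worldline := fun t =>
    ⟨t / c, by
      change event (c * (t / c)) _ = _
      rw [mul_div_cancel₀ _ hc.ne']⟩
  have h0 : (0 : ℝ) ∈ Icc (0 : ℝ) 1 := left_mem_Icc.2 zero_le_one
  have h1 : (1 : ℝ) ∈ Icc (0 : ℝ) 1 := right_mem_Icc.2 zero_le_one
  refine ⟨hV, hV, subset_rfl, hin hab.left ha, hin hab.right hb, fun x hx => ⟨?_, ?_⟩⟩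
  · have hxs := hsp hx.1
    obtain ⟨γ, hγ, e0, e1⟩ := hP.exists_future h hL hε hε1 hab.symm
      (x 0 - L * S.travelTime x₁ L Y W b a)
    rw [sub_add_cancel, ← hxs, event_spacePart] at e1
    refine ⟨γ, ⟨hγ, e0 ▸ hran _, e1⟩, fun δ hδ d0 d1 => ?_⟩
    exact hP.eqOn_of_future h hL hab.symm hδ (hsp d0) (by rw [d1, hxs]) hγ
      (by rw [e0, spacePart_event]) (by rw [e1, hxs]) h1 (by rw [d1, e1])
  · have hxs := hsp hx.1
    obtain ⟨γ, hγ, e0, e1⟩ := hP.exists_future h hL hε hε1 hab (x 0)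
    rw [← hxs, event_spacePart] at e0
    refine ⟨fun s => γ (1 - s), ⟨?_, ?_, ?_⟩, fun δ hδ d0 d1 => ?_⟩
    · rw [isPast_iff_isFuture_reverse]
      simpa using hγ
    · simp only [sub_zero, e1]
      exact hran _
    · simp only [sub_self, e0]
    · rw [isPast_iff_isFuture_reverse] at hδ
      have := hP.eqOn_of_future h hL hab hδ (by simp only [sub_zero, d1, hxs])
        (by simp only [sub_self]; exact hsp d0) hγ (by rw [e0, hxs])
        (by rw [e1, spacePart_event]) h0 (by simp only [sub_zero, d1, e0])
      intro s hs
      have hs' : 1 - s ∈ Icc (0 : ℝ) 1 := ⟨by linarith [hs.2], by linarith [hs.1]⟩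
      simpa using this hs'

end Pairs

end

theorem mainTheorem1 (η : ℝ) (hη : 0 < η) :
    ∃ ε : ℝ, 0 < ε ∧
      ∀ (S : StaticSpacetime) (p : ℝ) (N : ℕ) (x₁ : Pos),
        0 < p → 0 < N → S.IsGentle ε x₁ (N * p) →
          ∃ (m : Fin 4 → OpenMachine S) (q r : Fin 4 → Pos),
            -- the first machine is placed at the given position, all four are at rest
            q 0 = x₁ ∧
            (∀ i, (m i).AtRest (q i)) ∧
            -- like the vertices of a regular tetrahedron
            (∀ i j, i ≠ j → dist (r i) (r j) = N * p) ∧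
            (∀ i, dist (q i) (r i) ≤ η * (N * p)) ∧
            -- the clock of the first machine has the proper period `p`
            (m 0).HasProperPeriod p ∧
            -- six two-way channels with null phases and echo counts `2 N`
            (∀ i j, i ≠ j →
              OpenMachine.RadarLinkable (cylinder (Metric.ball x₁ (2 * (N * p))))
                (cylinder (Metric.ball x₁ (2 * (N * p)))) (m i) (m j) ∧
              OpenMachine.IsChannel (cylinder (Metric.ball x₁ (2 * (N * p))))
                (m i) (m j) (nullPhasePairs N) ∧
              OpenMachine.HasEchoCount (cylinder (Metric.ball x₁ (2 * (N * p))))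
                (m i) (m j) (2 * N)) := by
  obtain ⟨κ, hκ, htet⟩ := exists_perturbed_tetrahedron hη
  set ε : ℝ := min (1 / 10 ^ 10) (κ / 10 ^ 14) with hεd
  have hε : 0 < ε := lt_min (by norm_num) (by positivity)
  have hε1 : ε ≤ 1 / 10 ^ 10 := min_le_left _ _
  have hε2 : 10 ^ 14 * ε ≤ κ := by
    have : ε ≤ κ / 10 ^ 14 := min_le_right _ _
    rw [le_div_iff₀ (by positivity)] at this
    linarith
  refine ⟨ε, hε, fun S p N x₁ hp hN h => ?_⟩
  have hN' : (0 : ℝ) < N := Nat.cast_pos.2 hN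
  have hL : 0 < N * p := mul_pos hN' hp
  set L : ℝ := N * p with hLd
  obtain ⟨Y, W, hP⟩ := h.exists_lightPaths hL hε.le hε1
  have h00 : (0 : Pos) ∈ Metric.ball (0 : Pos) 2 := Metric.mem_ball_self (by norm_num)
  have hlapse := StaticSpacetime.lapse_pos hL h.1 h00
  obtain ⟨q, hq0, hqη, hq8, hq⟩ := htet
    (fun z => S.travelTime x₁ L Y W z.1 z.2 ^ 2 - ‖z.2 - z.1‖ ^ 2) ((S.lapse x₁ L 0)⁻¹ - 1)
    ((hP.bddLip_travelTime h hL hε.le hε1).mono hε2)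
    (((h.lapse_inv hL hε.le (hε1.trans (by norm_num))).1 0 h00).trans (by linarith))
  have hsep : ∀ i j, i ≠ j → StaticSpacetime.Separated (q i) (q j) := by
    have hb : ∀ i, q i ∈ Metric.ball (0 : Pos) (5 / 4) := fun i => by
      have := norm_add_le (q i - tetra i) (tetra i)
      rw [sub_add_cancel] at this
      rw [mem_ball_zero_iff]
      linarith [hq8 i, norm_tetra_le i]
    refine fun i j hij => ⟨hb i, hb j, ?_⟩
    have h1 := norm_sub_le (q j - q i) ((q j - tetra j) - (q i - tetra i))
    rw [show (q j - q i) - ((q j - tetra j) - (q i - tetra i)) = tetra j - tetra i by abel,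
      norm_tetra_sub hij.symm] at h1
    linarith [norm_sub_le (q j - tetra j) (q i - tetra i), hq8 i, hq8 j]
  set c : ℝ := p / √(S.lapse x₁ L 0) with hcd
  have hs0 : 0 < √(S.lapse x₁ L 0) := Real.sqrt_pos.2 hlapse
  have hc : 0 < c := div_pos hp hs0
  have hTlt : ∀ i j, i < j → L * S.travelTime x₁ L Y W (q i) (q j) = c * N := fun i j hij => by
    have h1 := hq i j hij
    have h2 := hP.travelTime_pos h hL hε.le hε1 (hsep i j hij.ne)
    have h3 : S.travelTime x₁ L Y W (q i) (q j) ^ 2 = (√(S.lapse x₁ L 0))⁻¹ ^ 2 := by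
      rw [inv_pow, Real.sq_sqrt hlapse.le]
      linarith
    rw [(pow_left_inj₀ h2.le (inv_pos.2 hs0).le two_ne_zero).1 h3, hLd, hcd, div_eq_mul_inv]
    ring
  have hT : ∀ i j, i ≠ j → L * S.travelTime x₁ L Y W (q i) (q j) = c * N := fun i j hij => by
    rcases lt_or_gt_of_ne hij with hlt | hlt
    · exact hTlt i j hlt
    · rw [hP.travelTime_symm h hL hε.le hε1 (hsep j i hlt.ne)]
      exact hTlt j i hlt
  have hmem : ∀ i, x₁ + L • q i ∈ S.space := fun i => by
    obtain ⟨j, hij⟩ := exists_ne i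
    exact h.1 ((StaticSpacetime.scaled_mem hL).2
      (Metric.ball_subset_ball (by norm_num) (hsep i j hij.symm).left))
  refine ⟨fun i => restMachine S (x₁ + L • q i) (hmem i) c hc, fun i => x₁ + L • q i,
    fun i => x₁ + L • tetra i, by simp [hq0], fun i _ => rfl, fun i j hij => ?_, fun i => ?_, ?_,
    fun i j hij => ⟨restMachine_radarLinkable hP h hL hε.le hε1 (hsep i j hij) hc _ _,
      restMachine_isChannel hP h hL hε.le hε1 (hsep i j hij) hc (hT i j hij) _ _,
      restMachine_hasEchoCount hP h hL hε.le hε1 (hsep i j hij) hc (hT i j hij) _ _⟩⟩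
  · rw [dist_eq_norm, add_sub_add_left_eq_sub, ← smul_sub, norm_smul, norm_tetra_sub hij,
      Real.norm_eq_abs, abs_of_pos hL, mul_one]
  · rw [dist_eq_norm, add_sub_add_left_eq_sub, ← smul_sub, norm_smul, Real.norm_eq_abs,
      abs_of_pos hL, mul_comm]
    exact mul_le_mul_of_nonneg_right (hqη i) hL.le
  · have h1 := restMachine_hasProperPeriod (hmem 0) hc
    have h2 : -S.metric (event 0 (x₁ + L • q 0)) 0 0 = S.lapse x₁ L 0 := by rw [hq0]; rfl
    have h3 : √(S.lapse x₁ L 0) * c = p := mul_div_cancel₀ _ hs0.ne'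
    rwa [h2, h3] at h1
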